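/- **Setting.** Let $d\ge 1$. Let $R_k=\prod_{i=1}^d[0,2^{a_i(k)})\subset\mathbb Z^d$, $k\ge 0$, be dyadic rectangles with $a_i(k)$ non-negative integers, non-decreasing in $k$, $a_i(0)=0$ for all $i$, and $a_i(k)<a_i(k+1)$ for at least one $i$, for each $k$. Put $H_k=\prod_i[-2^{a_i(k)},2^{a_i(k)})$, let $\sigma_k$ be the partition of $\mathbb Z^d$ into the atoms $Q=\prod_i 2^{a_i(k)}[m_i,m_i+1)$, $m\in\mathbb Z^d$, and let $\mathbb E_kf(x)$ be the average of $f$ over the atom of $\sigma_k$ containing $x$. For finite sets $E,F\subset\mathbb Z^d$ let $\partial E$ be the set of points of $E$ with a nearest neighbour outside $E$, and $B(E,F)=|\{x:\partial E\cap(F-x)\neq\emptyset\}|$. Let $c>0$ and let $\iota,\varepsilon:\{0,1,2,\dots\}\to[0,\infty)$ be summable. Let $\mathcal A_k$ $(k\ge0)$ be collections of finite subsets of $\mathbb Z^d$ such that, for all $k,l\ge 0$: (1) $E\subset H_k$ and (2) $c|H_k|\le|E|$ for each $E\in\mathcal A_k$; (3) $B(E,H_k)\le\iota(l)^2|H_{k+l}|$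 for each $E\in\mathcal A_{k+l}$; (4) $B(H_{k+l},H_k)\le\varepsilon(l)^2|H_{k+l}|$. Let $(E_t)_{t\ge1}$ be sets indexed by the positive integers such that $E_t\subset E_{t'}$ and $E_t,E_{t'}\in\mathcal A_k$ whenever $2^k\le t\le t'<2^{k+1}$. Let $M_{HL}f(x)=\sup_{Q\ni x}\frac1{|Q|}\sum_{y\in Q}|f(y)|$, the supremum being over all cubes $Q=\prod_i[m_i,m_i+n)$, $n\ge1$, containing $x$. The family is *cubic with constant $K$* if the sequence $(R_k)$ can be refined to a nested sequence of dyadic rectangles $\prod_i[0,2^{b_i(j)})$, $j\ge0$, $b(0)=0$, which contains every $R_k$ and whose consecutive members differ in size by a factor of exactly $2$, such that, with $H_j'=\prod_i[-2^{b_i(j)},2^{b_i(j)})$, $$\sup_{j}\ \sup_{y:\ x\in y+5H_j'}\frac1{|5H_j'|}\sum_{z\in y+5H_j'}|f(z)|\le K\,M_{HL}f(x)\quad\text{for all } f:\mathbb Z^d\to\mathbb C,\ x\in\mathbb Z^d.$$ A positive function $v$ on $\mathbb Z^d$ is an *$A_1$ weight with constant $A$* if $M_{HL}v\le A\,v$ pointwise.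 With $A_tf(x)=\frac1{|E_t|}\sum_{y\in E_t}f(x-y)$ define $$\mathcal S^L_kf=\sup_{2^k\le t<2^{k+1}}|A_tf-\mathbb E_kf|,\qquad \mathcal S^S_kf=\sup\Big(\sum_{i<n}|A_{t_i}f-A_{t_{i+1}}f|^2\Big)^{1/2},$$ the last supremum being over all finite sequences $2^k\le t_0<t_1<\dots<t_n<2^{k+1}$. For $*=L,S$ put $$\tilde{\mathcal S}^*_kf(x)=\sup_{h\in H_k}\mathcal S^*_kf(x+h),\qquad \mathcal S^*_{D,k}f=\sum_{Q\in\sigma_k}\tilde{\mathcal S}^*_kf(x_Q)\,1_{3Q},\qquad \mathcal S^*_Df=\Big(\sum_{k\ge0}|\mathcal S^*_{D,k}f|^2\Big)^{1/2},$$ where the sum is over the atoms $Q=\prod_i2^{a_i(k)}[m_i,m_i+1)$ of $\sigma_k$, $x_Q$ is the lattice centre of $Q$, with coordinates $2^{a_i(k)}m_i+\lfloor 2^{a_i(k)}/2\rfloor$, and $3Q=\prod_i2^{a_i(k)}[m_i-1,m_i+2)$. **Proposition (Weighted $L^{1,\infty}$).** For all $d$, $c$, $K$, $A$ and all summable $\iota,\varepsilon$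 there is a constant $C_1<\infty$, depending only on $\iota$, $\varepsilon$, $d$, $c$, $K$ and $A$, such that for every family as above that is cubic with constant $K$, every $A_1$ weight $v$ with constant $A$, every $f:\mathbb Z^d\to\mathbb C$, every $\lambda\ge0$, and both $*=L$ and $*=S$, $$\lambda\,v(\{\mathcal S^*_Df>\lambda\})\le C_1\sum_{x\in\mathbb Z^d}|f(x)|\,v(x),$$ where $v(S)=\sum_{x\in S}v(x)$. -/

import Mathlib

open scoped NNReal ENNReal

noncomputable section

namespace ShiftedSquare

variable {d : ℕ}

/-! Rectangles in `ℤ^d = Fin d → ℤ`. A vector `e : Fin d → ℕ` holds the dyadic exponents of the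
side lengths; all sets of integers are integer points of half-open boxes. -/

/-- The atom `∏ i, 2 ^ e i * [m i, m i + 1)` of the dyadic partition with exponents `e`. -/
def atom (e : Fin d → ℕ) (m : Fin d → ℤ) : Finset (Fin d → ℤ) :=
  Fintype.piFinset fun i => Finset.Ico (2 ^ e i * m i) (2 ^ e i * (m i + 1))

/-- The index of the atom that contains `x` (integer division rounds down). -/
def atomIndex (e : Fin d → ℕ) (x : Fin d → ℤ) : Fin d → ℤ := fun i => x i / 2 ^ e i

/-- The lattice centre `2 ^ e i * m i + 2 ^ (e i - 1)` of an atom; in a direction of side length `1`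
it is the only point of the side. -/
def atomCenter (e : Fin d → ℕ) (m : Fin d → ℤ) : Fin d → ℤ := fun i => 2 ^ e i * m i + 2 ^ e i / 2

/-- The concentric triple `3Q` of an atom `Q`, the union of `Q` and its neighbours. -/
def tripleAtom (e : Fin d → ℕ) (m : Fin d → ℤ) : Finset (Fin d → ℤ) :=
  Fintype.piFinset fun i => Finset.Ico (2 ^ e i * (m i - 1)) (2 ^ e i * (m i + 2))

/-- The dilated symmetric rectangle `r H = ∏ i, [-r 2 ^ e i, r 2 ^ e i)`. -/
def symBox (r : ℕ) (e : Fin d → ℕ) : Finset (Fin d → ℤ) :=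
  Fintype.piFinset fun i => Finset.Ico (-((r : ℤ) * 2 ^ e i)) ((r : ℤ) * 2 ^ e i)

/-- The symmetric rectangle `H = ∏ i, [-2 ^ e i, 2 ^ e i)`. -/
abbrev H (e : Fin d → ℕ) : Finset (Fin d → ℤ) := symBox 1 e

/-- The cube `∏ i, [m i, m i + n)`. -/
def cube (m : Fin d → ℤ) (n : ℕ) : Finset (Fin d → ℤ) :=
  Fintype.piFinset fun i => Finset.Ico (m i) (m i + n)

/-- The points of `E` that have a nearest neighbour outside `E`. -/
def boundary (E : Finset (Fin d → ℤ)) : Set (Fin d → ℤ) :=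
  {y | y ∈ E ∧ ∃ i, y + Pi.single i 1 ∉ E ∨ y - Pi.single i 1 ∉ E}

/-- `B(E, F) = |{x : ∂E ∩ (F - x) ≠ ∅}|`. -/
def boundaryCount (E F : Finset (Fin d → ℤ)) : ℕ :=
  Set.ncard {x : Fin d → ℤ | ∃ h ∈ F, h - x ∈ boundary E}

/-! The families of sets. -/

/-- `a k` are the exponents of a nested sequence of dyadic rectangles
`{0} = R 0 ⊂ R 1 ⊂ ⋯`, `R k = ∏ i, [0, 2 ^ a k i)`, each strictly larger than the one before. -/
structure IsDyadicSequence (a : ℕ → Fin d → ℕ) : Prop where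
  zero : a 0 = 0
  mono : Monotone a
  strict : ∀ k, ∃ i, a k i < a (k + 1) i

/-- The four criteria (location, size, smoothness, eccentricity) on collections `𝒜 k` of sets. -/
structure JRWCriteria (c : ℝ) (ι ε : ℕ → ℝ≥0) (a : ℕ → Fin d → ℕ)
    (𝒜 : ℕ → Set (Finset (Fin d → ℤ))) : Prop where
  location : ∀ k, ∀ E ∈ 𝒜 k, E ⊆ H (a k)
  size : ∀ k, ∀ E ∈ 𝒜 k, c * (H (a k)).card ≤ E.card
  smoothness : ∀ k l, ∀ E ∈ 𝒜 (k + l),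
    (boundaryCount E (H (a k)) : ℝ) / (H (a (k + l))).card ≤ (ι l : ℝ) ^ 2
  eccentricity : ∀ k l,
    (boundaryCount (H (a (k + l))) (H (a k)) : ℝ) / (H (a (k + l))).card ≤ (ε l : ℝ) ^ 2

/-- The sets `E t`, `t ≥ 1`, are regular with respect to `𝒜`. -/
def IsRegular (𝒜 : ℕ → Set (Finset (Fin d → ℤ))) (E : ℕ → Finset (Fin d → ℤ)) : Prop :=
  ∀ k t t' : ℕ, 2 ^ k ≤ t → t ≤ t' → t' < 2 ^ (k + 1) → E t ⊆ E t' ∧ E t ∈ 𝒜 k ∧ E t' ∈ 𝒜 k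

/-- `b` refines `a`: consecutive rectangles of `b` differ in size by a factor of exactly `2`, and
every rectangle of `a` is one of `b`. -/
structure IsRefinement (a b : ℕ → Fin d → ℕ) : Prop where
  zero : b 0 = 0
  mono : Monotone b
  step : ∀ j, ∑ i, b (j + 1) i = (∑ i, b j i) + 1
  contains : ∃ J : ℕ → ℕ, StrictMono J ∧ ∀ k, b (J k) = a k

/-- The average of `|f|` over a finite set. -/
def absAverage {F : Type*} [ENorm F] (S : Finset (Fin d → ℤ)) (f : (Fin d → ℤ) → F) : ℝ≥0∞ :=
  (∑ y ∈ S, ‖f y‖ₑ) / S.card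

/-- The uncentered cubic Hardy--Littlewood maximal function. -/
def maximalHL {F : Type*} [ENorm F] (f : (Fin d → ℤ) → F) (x : Fin d → ℤ) : ℝ≥0∞ :=
  ⨆ (m : Fin d → ℤ) (n : ℕ) (_ : 0 < n) (_ : x ∈ cube m n), absAverage (cube m n) f

/-- The uncentered maximal function over all translates of the `5 H'_j`, `H'_j` the symmetric
rectangles with exponents `b j`. -/
def maximalRect (b : ℕ → Fin d → ℕ) (f : (Fin d → ℤ) → ℂ) (x : Fin d → ℤ) : ℝ≥0∞ :=
  ⨆ (j : ℕ) (y : Fin d → ℤ) (_ : x - y ∈ symBox 5 (b j)),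
    absAverage ((symBox 5 (b j)).image fun z => y + z) f

/-- The rectangles are cubic with constant `K`: for a refinement of the rectangles, the rectangular
maximal function is at most `K` times the Hardy--Littlewood maximal function. -/
def IsCubic (K : ℝ≥0) (a : ℕ → Fin d → ℕ) : Prop :=
  ∃ b, IsRefinement a b ∧ ∀ f x, maximalRect b f x ≤ K * maximalHL f x

/-- `v` is a (positive) `A_1` weight with constant `A`. -/
structure IsA1Weight (A : ℝ≥0) (v : (Fin d → ℤ) → ℝ) : Prop where
  pos : ∀ x, 0 < v x
  maximal_le : ∀ x, maximalHL v x ≤ A * ENNReal.ofReal (v x)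

/-! The square functions. -/

/-- The convolution average `A f (x) = |E|⁻¹ ∑_{y ∈ E} f (x - y)`. -/
def convAverage (E : Finset (Fin d → ℤ)) (f : (Fin d → ℤ) → ℂ) (x : Fin d → ℤ) : ℂ :=
  (E.card : ℂ)⁻¹ * ∑ y ∈ E, f (x - y)

/-- The expectation of `f` with respect to the dyadic partition with exponents `e`. -/
def dyadicExpectation (e : Fin d → ℕ) (f : (Fin d → ℤ) → ℂ) (x : Fin d → ℤ) : ℂ :=
  ((atom e (atomIndex e x)).card : ℂ)⁻¹ * ∑ y ∈ atom e (atomIndex e x), f y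

/-- The part at scale `k` of the long square function. -/
def longPart (a : ℕ → Fin d → ℕ) (E : ℕ → Finset (Fin d → ℤ)) (k : ℕ)
    (f : (Fin d → ℤ) → ℂ) (x : Fin d → ℤ) : ℝ≥0∞ :=
  ⨆ t ∈ Set.Ico (2 ^ k) (2 ^ (k + 1)), ‖convAverage (E t) f x - dyadicExpectation (a k) f x‖ₑ

/-- The part at scale `k` of the short square function; the supremum is over all finite increasing
sequences `t 0 < ⋯ < t n` in `[2 ^ k, 2 ^ (k + 1))`. -/
def shortPart (E : ℕ → Finset (Fin d → ℤ)) (k : ℕ)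
    (f : (Fin d → ℤ) → ℂ) (x : Fin d → ℤ) : ℝ≥0∞ :=
  (⨆ (n : ℕ) (t : ℕ → ℕ) (_ : StrictMonoOn t (Set.Iic n))
      (_ : ∀ i ≤ n, t i ∈ Set.Ico (2 ^ k) (2 ^ (k + 1))),
    ∑ i ∈ Finset.range n, ‖convAverage (E (t i)) f x - convAverage (E (t (i + 1))) f x‖ₑ ^ 2)
    ^ (1 / 2 : ℝ)

/-- The shifted version `x ↦ sup_{h ∈ H} s (x + h)` of a function `s`. -/
def shifted (e : Fin d → ℕ) (s : (Fin d → ℤ) → ℝ≥0∞) (x : Fin d → ℤ) : ℝ≥0∞ :=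
  ⨆ h ∈ H e, s (x + h)

/-- The discretization `∑_Q (shifted s)(x_Q) 1_{3Q}`, the sum being over all atoms `Q`. -/
def discretized (e : Fin d → ℕ) (s : (Fin d → ℤ) → ℝ≥0∞) (x : Fin d → ℤ) : ℝ≥0∞ :=
  ∑' m : Fin d → ℤ,
    Set.indicator (tripleAtom e m : Set (Fin d → ℤ)) (fun _ => shifted e s (atomCenter e m)) x

/-- The discretized shifted long square function. -/
def longSquare (a : ℕ → Fin d → ℕ) (E : ℕ → Finset (Fin d → ℤ))
    (f : (Fin d → ℤ) → ℂ) (x : Fin d → ℤ) : ℝ≥0∞ :=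
  (∑' k, discretized (a k) (longPart a E k f) x ^ 2) ^ (1 / 2 : ℝ)

/-- The discretized shifted short square function. -/
def shortSquare (a : ℕ → Fin d → ℕ) (E : ℕ → Finset (Fin d → ℤ))
    (f : (Fin d → ℤ) → ℂ) (x : Fin d → ℤ) : ℝ≥0∞ :=
  (∑' k, discretized (a k) (shortPart E k f) x ^ 2) ^ (1 / 2 : ℝ)

/-- The weighted size `v(S) = ∑_{x ∈ S} v x`. -/
def weightOf (v : (Fin d → ℤ) → ℝ) (S : Set (Fin d → ℤ)) : ℝ≥0∞ :=
  ∑' x, S.indicator (fun x => ENNReal.ofReal (v x)) x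

/-- The weighted integral `∫ |f| v = ∑_x |f x| v x`. -/
def weightedIntegral (v : (Fin d → ℤ) → ℝ) (f : (Fin d → ℤ) → ℂ) : ℝ≥0∞ :=
  ∑' x, ‖f x‖ₑ * ENNReal.ofReal (v x)

end ShiftedSquare

end

noncomputable section

namespace ShiftedSquare

variable {d : ℕ}

/-! The square functions are used only through the properties in `ScaleOperators`: at scale `k` they
are sublinear, local, zero where the function is locally constant, bounded by a local ℓ² average,
and small of order `ι (k - i)` on functions with mean zero on the atoms of a finer partition σ_i.
The smallness holds because atoms contained in an averaging set contribute nothing, and the atoms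
that cross its boundary are counted by B(E, H_i) (`sq_sum_sdiff_le`). In the short case the
increments of nested sets are disjoint, so their contributions add up. Discretization keeps these
properties (`ScaleOperators.discretized`) and makes the functions constant on atoms.

Unweighted ℓ² (`ScaleOperators.tsum_sq_le`): decompose f into martingale differences. Those finer
than scale k are damped by mean zero; those coarser are constant on large atoms, so they are seen
only near the boundaries of these atoms, and eccentricity makes such layers thin. A Schur test sums
over pairs of scales.

Weighted ℓ² (`ScaleOperators.tsum_sq_mul_le`): since the operators are constant on atoms, the A_1
condition allows the weight to be replaced by its minimum over a neighbourhood. Where this minimum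
exceeds s, locality permits f to be replaced by f restricted to {v > s}. The unweighted estimate,
integrated over s, gives the weighted one.

Weak type (`ScaleOperators.weak_type_of_summable`): a Calderón–Zygmund decomposition along the
refinement, whose doubling steps keep stopping averages below 2λ. Enlarged stopping cells form an
exceptional set controlled by the A_1 condition. The good part is treated in weighted ℓ². The bad
part is grouped by the first scale i of the original sequence whose atoms contain its cells; off the
exceptional set only groups i ≤ k are seen at scale k. Cancellation applies to these with the
majorant 4λ|β_i|, linear in the bad function β_i, so the squares sum to λ times a weighted ℓ¹ norm.
-/

/-- The number `∏ i, 2 ^ e i` of points of an atom with exponents `e`. -/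
def vol (e : Fin d → ℕ) : ℕ := ∏ i, 2 ^ e i

/-- The closed box of radii `r 2 ^ e i` around `x`. -/
def nb (r : ℕ) (e : Fin d → ℕ) (x : Fin d → ℤ) : Finset (Fin d → ℤ) :=
  Fintype.piFinset fun i => Finset.Icc (x i - r * 2 ^ e i) (x i + r * 2 ^ e i)

/-! ### Boxes and atoms: membership and cardinality. -/

theorem mem_nb {r : ℕ} {e : Fin d → ℕ} {x y : Fin d → ℤ} :
    y ∈ nb r e x ↔ ∀ i, |y i - x i| ≤ r * 2 ^ e i := by
  simp only [nb, Fintype.mem_piFinset, Finset.mem_Icc, abs_le]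
  exact forall_congr' fun i => ⟨fun h => ⟨by linarith, by linarith⟩, fun h => ⟨by linarith, by linarith⟩⟩

theorem mem_nb_comm {r : ℕ} {e : Fin d → ℕ} {x y : Fin d → ℤ} : y ∈ nb r e x ↔ x ∈ nb r e y := by
  simp only [mem_nb, abs_sub_comm]

theorem self_mem_nb (r : ℕ) (e : Fin d → ℕ) (x : Fin d → ℤ) : x ∈ nb r e x := by
  simp only [mem_nb, sub_self, abs_zero]
  intro i
  positivity

theorem vol_pos (e : Fin d → ℕ) : 0 < vol e := Finset.prod_pos fun _ _ => by positivity

theorem vol_ne_zero (e : Fin d → ℕ) : (vol e : ℝ≥0∞) ≠ 0 := by exact_mod_cast (vol_pos e).ne'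

theorem vol_mul_inv (e : Fin d → ℕ) : (vol e : ℝ≥0∞) * (vol e : ℝ≥0∞)⁻¹ = 1 :=
  ENNReal.mul_inv_cancel (vol_ne_zero e) (ENNReal.natCast_ne_top _)

theorem vol_eq (e : Fin d → ℕ) : vol e = 2 ^ ∑ i, e i := by
  rw [vol, Finset.prod_pow_eq_pow_sum]

theorem card_nb_le (r : ℕ) (e : Fin d → ℕ) (x : Fin d → ℤ) :
    (nb r e x).card ≤ (2 * r + 1) ^ d * vol e := by
  rw [nb, Fintype.card_piFinset, vol]
  calc ∏ i, (Finset.Icc (x i - r * 2 ^ e i) (x i + r * 2 ^ e i)).card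
      ≤ ∏ i : Fin d, (2 * r + 1) * 2 ^ e i := by
        refine Finset.prod_le_prod' fun i _ => ?_
        rw [Int.card_Icc, Int.toNat_le]
        have : (1 : ℤ) ≤ 2 ^ e i := one_le_pow₀ (by norm_num)
        push_cast
        nlinarith
    _ = _ := by rw [Finset.prod_mul_distrib]; simp

theorem card_symBox (r : ℕ) (e : Fin d → ℕ) : (symBox r e).card = (2 * r) ^ d * vol e := by
  rw [symBox, Fintype.card_piFinset, vol]
  have : ∀ i, (Finset.Ico (-((r : ℤ) * 2 ^ e i)) ((r : ℤ) * 2 ^ e i)).card = 2 * r * 2 ^ e i := by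
    intro i
    rw [Int.card_Ico]
    have : (r : ℤ) * 2 ^ e i - -((r : ℤ) * 2 ^ e i) = ((2 * r * 2 ^ e i : ℕ) : ℤ) := by
      push_cast; ring
    rw [this, Int.toNat_natCast]
  simp_rw [this, Finset.prod_mul_distrib]
  simp [mul_pow]

theorem card_atom (e : Fin d → ℕ) (m : Fin d → ℤ) : (atom e m).card = vol e := by
  rw [atom, Fintype.card_piFinset, vol]
  refine Finset.prod_congr rfl fun i _ => ?_
  rw [Int.card_Ico]
  have : (2 : ℤ) ^ e i * (m i + 1) - 2 ^ e i * m i = ((2 ^ e i : ℕ) : ℤ) := by push_cast; ring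
  rw [this, Int.toNat_natCast]

theorem ediv_eq_iff (n : ℕ) (x m : ℤ) : x / 2 ^ n = m ↔ 2 ^ n * m ≤ x ∧ x < 2 ^ n * (m + 1) := by
  have h : (0 : ℤ) < 2 ^ n := by positivity
  rw [le_antisymm_iff, Int.le_ediv_iff_mul_le h, ← Int.lt_add_one_iff, Int.ediv_lt_iff_lt_mul h,
    mul_comm m, mul_comm (m + 1)]
  exact and_comm

theorem mem_atom {e : Fin d → ℕ} {m x : Fin d → ℤ} : x ∈ atom e m ↔ atomIndex e x = m := by
  simp only [atom, Fintype.mem_piFinset, Finset.mem_Ico, funext_iff, atomIndex, ediv_eq_iff]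

theorem mem_atom' {e : Fin d → ℕ} {m x : Fin d → ℤ} :
    x ∈ atom e m ↔ ∀ i, 2 ^ e i * m i ≤ x i ∧ x i < 2 ^ e i * (m i + 1) := by
  simp only [atom, Fintype.mem_piFinset, Finset.mem_Ico]

theorem mem_atom_self (e : Fin d → ℕ) (x : Fin d → ℤ) : x ∈ atom e (atomIndex e x) :=
  mem_atom.2 rfl

theorem atomIndex_mono {e e' : Fin d → ℕ} (h : e ≤ e') {x y : Fin d → ℤ}
    (hxy : atomIndex e x = atomIndex e y) : atomIndex e' x = atomIndex e' y := by
  funext i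
  have hi := congrFun hxy i
  simp only [atomIndex] at hi ⊢
  obtain ⟨n, hn⟩ := Nat.exists_eq_add_of_le (h i)
  rw [hn, pow_add, ← Int.ediv_ediv_of_nonneg (by positivity), hi, Int.ediv_ediv_of_nonneg (by positivity)]

theorem abs_sub_lt_of_atomIndex_eq {e : Fin d → ℕ} {x y : Fin d → ℤ}
    (hxy : atomIndex e x = atomIndex e y) (i : Fin d) : |x i - y i| < 2 ^ e i := by
  have hx := mem_atom'.1 (mem_atom_self e x) i
  have hy := mem_atom'.1 (mem_atom.2 hxy.symm) i
  rw [abs_lt]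
  constructor <;> linarith [hx.1, hx.2, hy.1, hy.2]

theorem atomIndex_zero (x : Fin d → ℤ) : atomIndex 0 x = x := by
  funext i
  simp [atomIndex]

theorem atom_zero (x : Fin d → ℤ) : atom 0 x = {x} := by
  ext y
  simp [mem_atom, atomIndex_zero]

/-! Sums over `ℤ^d`. -/

theorem tsum_eq_tsum_atom (e : Fin d → ℕ) (φ : (Fin d → ℤ) → ℝ≥0∞) :
    ∑' x, φ x = ∑' m, ∑ x ∈ atom e m, φ x := by
  rw [← (Equiv.sigmaFiberEquiv (atomIndex e)).tsum_eq, ENNReal.tsum_sigma']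
  refine tsum_congr fun m => ?_
  rw [← Finset.tsum_subtype (atom e m) φ]
  exact (Equiv.subtypeEquivRight fun x => (mem_atom (e := e) (m := m)).symm).tsum_eq
    (fun x => φ x.1)

theorem tsum_mul_sum_comm (S : (Fin d → ℤ) → Finset (Fin d → ℤ)) (hS : ∀ x y, y ∈ S x ↔ x ∈ S y)
    (φ ψ : (Fin d → ℤ) → ℝ≥0∞) :
    ∑' x, ψ x * ∑ y ∈ S x, φ y = ∑' y, φ y * ∑ x ∈ S y, ψ x := by
  classical
  have h : ∀ φ : (Fin d → ℤ) → ℝ≥0∞, ∀ x, ∑ y ∈ S x, φ y = ∑' y, if y ∈ S x then φ y else 0 := by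
    intro φ x
    rw [tsum_eq_sum (s := S x) (fun y hy => if_neg hy)]
    exact Finset.sum_congr rfl fun y hy => (if_pos hy).symm
  simp_rw [h, ← ENNReal.tsum_mul_left]
  rw [ENNReal.tsum_comm]
  refine tsum_congr fun y => tsum_congr fun x => ?_
  simp only [hS x y]
  split_ifs
  · rw [mul_comm]
  · simp

/-! ### Cauchy–Schwarz and square roots for extended nonnegative reals. -/

/-- The Cauchy--Schwarz inequality with weights `u`. -/
theorem sq_sum_le_weighted {κ : Type*} (I : Finset κ) (u s : κ → ℝ≥0∞) (h0 : ∀ i, u i ≠ 0)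
    (ht : ∀ i, u i ≠ ⊤) :
    (∑ i ∈ I, s i) ^ 2 ≤ (∑ i ∈ I, u i) * ∑ i ∈ I, (u i)⁻¹ * s i ^ 2 := by
  have h := ENNReal.inner_le_Lp_mul_Lq I (fun i => u i ^ (1 / 2 : ℝ))
    (fun i => (u i)⁻¹ ^ (1 / 2 : ℝ) * s i) (p := 2) (q := 2) Real.HolderConjugate.two_two
  have e1 : ∀ i, u i ^ (1 / 2 : ℝ) * ((u i)⁻¹ ^ (1 / 2 : ℝ) * s i) = s i := by
    intro i
    rw [← mul_assoc, ← ENNReal.mul_rpow_of_nonneg _ _ (by norm_num),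
      ENNReal.mul_inv_cancel (h0 i) (ht i), ENNReal.one_rpow, one_mul]
  have e2 : ∀ i, (u i ^ (1 / 2 : ℝ)) ^ (2 : ℝ) = u i := by
    intro i
    rw [← ENNReal.rpow_mul]; norm_num
  have e3 : ∀ i, ((u i)⁻¹ ^ (1 / 2 : ℝ) * s i) ^ (2 : ℝ) = (u i)⁻¹ * s i ^ 2 := by
    intro i
    rw [ENNReal.mul_rpow_of_nonneg _ _ (by norm_num), ← ENNReal.rpow_mul]
    norm_num
  simp_rw [e1, e2, e3] at h
  calc (∑ i ∈ I, s i) ^ 2 ≤ _ := pow_le_pow_left' h 2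
    _ = _ := by
      rw [mul_pow, ← ENNReal.rpow_natCast, ← ENNReal.rpow_natCast, ← ENNReal.rpow_mul,
        ← ENNReal.rpow_mul]
      norm_num

theorem sq_tsum_le_weighted (u s : ℕ → ℝ≥0∞) (h0 : ∀ i, u i ≠ 0) (ht : ∀ i, u i ≠ ⊤) :
    (∑' i, s i) ^ 2 ≤ (∑' i, u i) * ∑' i, (u i)⁻¹ * s i ^ 2 := by
  have h : Filter.Tendsto (fun n => (∑ i ∈ Finset.range n, s i) ^ 2) Filter.atTop
      (nhds ((∑' i, s i) ^ 2)) :=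
    (ENNReal.continuous_pow 2).continuousAt.tendsto.comp ENNReal.summable.hasSum.tendsto_sum_nat
  refine le_of_tendsto' h fun n => (sq_sum_le_weighted _ u s h0 ht).trans ?_
  gcongr <;> exact ENNReal.sum_le_tsum _

theorem sq_sum_le_card_mul {κ : Type*} (I : Finset κ) (s : κ → ℝ≥0∞) :
    (∑ i ∈ I, s i) ^ 2 ≤ I.card * ∑ i ∈ I, s i ^ 2 := by
  have := sq_sum_le_weighted I (fun _ => 1) s (by simp) (by simp)
  simpa using this

theorem rpow_half_sq (M : ℝ≥0∞) : (M ^ (1 / 2 : ℝ)) ^ 2 = M := by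
  rw [← ENNReal.rpow_natCast, ← ENNReal.rpow_mul]
  norm_num

theorem lt_rpow_half_iff {x M : ℝ≥0∞} : x < M ^ (1 / 2 : ℝ) ↔ x ^ 2 < M := by
  rw [← (ENNReal.pow_right_strictMono two_ne_zero).lt_iff_lt, rpow_half_sq]

theorem le_rpow_half_iff {x M : ℝ≥0∞} : x ≤ M ^ (1 / 2 : ℝ) ↔ x ^ 2 ≤ M := by
  rw [← (ENNReal.pow_right_strictMono two_ne_zero).le_iff_le, rpow_half_sq]

theorem add_sq_le_two (x y : ℝ≥0∞) : (x + y) ^ 2 ≤ 2 * x ^ 2 + 2 * y ^ 2 := by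
  have := sq_sum_le_card_mul (Finset.univ : Finset (Fin 2)) ![x, y]
  simpa [mul_add] using this

/-! ### Mean zero, majorants and the abstract operators. -/

/-- All sums of `f` over atoms vanish. -/
def MeanZero (e : Fin d → ℕ) (f : (Fin d → ℤ) → ℂ) : Prop := ∀ m, ∑ y ∈ atom e m, f y = 0

/-- `U` is a union of atoms. -/
def IsUnionOfAtoms (e : Fin d → ℕ) (U : Finset (Fin d → ℤ)) : Prop :=
  ∀ x y, x ∈ U → atomIndex e x = atomIndex e y → y ∈ U

/-- `h` controls squares of sums of `|f|` over parts of unions of atoms. -/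
def IsMajorant (e : Fin d → ℕ) (f : (Fin d → ℤ) → ℂ) (h : (Fin d → ℤ) → ℝ≥0∞) : Prop :=
  ∀ S U : Finset (Fin d → ℤ), IsUnionOfAtoms e U →
    (∑ y ∈ S ∩ U, ‖f y‖ₑ) ^ 2 ≤ U.card * ∑ y ∈ S, h y

/-- Sublinear operators `T k`, acting at the scale of the rectangles with exponents `a k`, that
annihilate constants, are bounded on `ℓ²` and almost annihilate functions of mean zero on the atoms
of much smaller scales. -/
structure ScaleOperators (a : ℕ → Fin d → ℕ) (ι : ℕ → ℝ≥0) (C : ℝ≥0) (r : ℕ)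
    (T : ℕ → ((Fin d → ℤ) → ℂ) → (Fin d → ℤ) → ℝ≥0∞) : Prop where
  congr : ∀ k f g x, (∀ y ∈ nb r (a k) x, f y = g y) → T k f x = T k g x
  add_le : ∀ k f g x, T k (f + g) x ≤ T k f x + T k g x
  const : ∀ k f z x, (∀ y ∈ nb r (a k) x, f y = z) → T k f x = 0
  sq_le : ∀ k f x, T k f x ^ 2 ≤ C * ((vol (a k) : ℝ≥0∞)⁻¹ * ∑ y ∈ nb r (a k) x, ‖f y‖ₑ ^ 2)
  cancel : ∀ i k f h x, i ≤ k → MeanZero (a i) f → IsMajorant (a i) f h →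
    T k f x ^ 2 ≤ C * ((ι (k - i) : ℝ≥0∞) ^ 2 * ((vol (a k) : ℝ≥0∞)⁻¹ * ∑ y ∈ nb r (a k) x, h y))

/-- Plain Cauchy–Schwarz; this majorant serves the ℓ² theory. -/
theorem IsMajorant.sq {e : Fin d → ℕ} {f : (Fin d → ℤ) → ℂ} :
    IsMajorant e f fun y => ‖f y‖ₑ ^ 2 := by
  intro S U _
  refine (sq_sum_le_card_mul _ _).trans ?_
  gcongr
  · exact Finset.inter_subset_right
  · exact Finset.inter_subset_left

/-- One factor of the square is bounded through the density of `f` on `U`, the other is kept. The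
majorant is linear in |f|, which turns the cancellation estimate into the ℓ¹ bound needed for the
bad part. -/
theorem IsMajorant.mul {e : Fin d → ℕ} {f : (Fin d → ℤ) → ℂ} {L : ℝ≥0∞}
    (h : ∀ U, IsUnionOfAtoms e U → ∑ y ∈ U, ‖f y‖ₑ ≤ L * U.card) :
    IsMajorant e f fun y => L * ‖f y‖ₑ := by
  intro S U hU
  rw [pow_two, ← Finset.mul_sum]
  calc (∑ y ∈ S ∩ U, ‖f y‖ₑ) * (∑ y ∈ S ∩ U, ‖f y‖ₑ)
      ≤ (∑ y ∈ U, ‖f y‖ₑ) * ∑ y ∈ S, ‖f y‖ₑ := by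
        gcongr
        · exact Finset.inter_subset_right
        · exact Finset.inter_subset_left
    _ ≤ (L * U.card) * ∑ y ∈ S, ‖f y‖ₑ := by gcongr; exact h U hU
    _ = _ := by ring

/-! Sums over unions of atoms. -/

theorem isUnionOfAtoms_atom {e e' : Fin d → ℕ} (h : e ≤ e') (m : Fin d → ℤ) :
    IsUnionOfAtoms e (atom e' m) := by
  intro x y hx hxy
  rw [mem_atom] at hx ⊢
  rw [← hx]
  exact (atomIndex_mono h hxy).symm

theorem sum_eq_sum_atoms {M : Type*} [AddCommMonoid M] {e : Fin d → ℕ} {U : Finset (Fin d → ℤ)}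
    (hU : IsUnionOfAtoms e U) (f : (Fin d → ℤ) → M) :
    ∑ y ∈ U, f y = ∑ m ∈ U.image (atomIndex e), ∑ y ∈ atom e m, f y := by
  classical
  rw [← Finset.sum_fiberwise_of_maps_to (g := atomIndex e) (t := U.image (atomIndex e))
    (fun x hx => Finset.mem_image_of_mem _ hx)]
  refine Finset.sum_congr rfl fun m hm => Finset.sum_congr ?_ fun _ _ => rfl
  obtain ⟨x, hx, rfl⟩ := Finset.mem_image.1 hm
  ext y
  simp only [Finset.mem_filter, mem_atom]
  exact ⟨fun h => h.2, fun h => ⟨hU x y hx h.symm, h⟩⟩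

theorem MeanZero.sum_eq_zero {e : Fin d → ℕ} {f : (Fin d → ℤ) → ℂ} (hf : MeanZero e f)
    {U : Finset (Fin d → ℤ)} (hU : IsUnionOfAtoms e U) : ∑ y ∈ U, f y = 0 := by
  rw [sum_eq_sum_atoms hU]
  exact Finset.sum_eq_zero fun m _ => hf m

/-! The discretization. -/

theorem mem_tripleAtom {e : Fin d → ℕ} {m x : Fin d → ℤ} :
    x ∈ tripleAtom e m ↔ m ∈ Fintype.piFinset fun i =>
      Finset.Icc (atomIndex e x i - 1) (atomIndex e x i + 1) := by
  simp only [tripleAtom, Fintype.mem_piFinset, Finset.mem_Ico, Finset.mem_Icc]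
  refine forall_congr' fun i => ?_
  have h : (0 : ℤ) < 2 ^ e i := by positivity
  have h1 : 2 ^ e i * (m i - 1) ≤ x i ↔ m i - 1 ≤ x i / 2 ^ e i := by
    rw [Int.le_ediv_iff_mul_le h, mul_comm]
  have h2 : x i < 2 ^ e i * (m i + 2) ↔ x i / 2 ^ e i < m i + 2 := by
    rw [Int.ediv_lt_iff_lt_mul h, mul_comm]
  rw [h1, h2, atomIndex]
  omega

theorem discretized_eq (e : Fin d → ℕ) (s : (Fin d → ℤ) → ℝ≥0∞) (x : Fin d → ℤ) :
    discretized e s x = ∑ m ∈ Fintype.piFinset fun i =>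
      Finset.Icc (atomIndex e x i - 1) (atomIndex e x i + 1), shifted e s (atomCenter e m) := by
  rw [discretized, tsum_eq_sum]
  · refine Finset.sum_congr rfl fun m hm => ?_
    rw [Set.indicator_of_mem]
    exact mem_tripleAtom.2 hm
  · intro m hm
    rw [Set.indicator_of_notMem]
    exact fun h => hm (mem_tripleAtom.1 h)

/-- Constancy on atoms is what later allows the weight to be replaced by its local minimum. -/
theorem discretized_congr_atom {e : Fin d → ℕ} (s : (Fin d → ℤ) → ℝ≥0∞) {x y : Fin d → ℤ}
    (h : atomIndex e x = atomIndex e y) : discretized e s x = discretized e s y := by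
  rw [discretized_eq, discretized_eq, h]

/-- In units of the side lengths: a point of the triple is within 2 of the lattice centre (3/2,
unless the side is a single point), the shift adds 1 and the inner box 1, whence 4. -/
theorem nb_subset_of_mem_tripleAtom {e : Fin d → ℕ} {m x h : Fin d → ℤ} (hx : x ∈ tripleAtom e m)
    (hh : h ∈ H e) : nb 1 e (atomCenter e m + h) ⊆ nb 4 e x := by
  intro y hy
  rw [mem_nb] at hy ⊢
  intro i
  have h1 := hy i
  simp only [tripleAtom, Fintype.mem_piFinset, Finset.mem_Ico] at hx
  simp only [symBox, Fintype.mem_piFinset, Finset.mem_Ico] at hh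
  have h2 := hx i
  have h3 := hh i
  simp only [atomCenter, Pi.add_apply, Nat.cast_one, one_mul, Nat.cast_ofNat] at h1 h3 ⊢
  have h4 : (0 : ℤ) < 2 ^ e i := by positivity
  have h5 : 0 ≤ (2 : ℤ) ^ e i / 2 := by positivity
  have h6 : (2 : ℤ) ^ e i / 2 * 2 ≤ 2 ^ e i := Int.ediv_mul_le _ (by norm_num)
  rw [abs_le] at h1 ⊢
  constructor <;> nlinarith [h1.1, h1.2, h2.1, h2.2, h3.1, h3.2]

/-- Exactly 3^d triples contain a given point. -/
theorem discretized_le {e : Fin d → ℕ} {s : (Fin d → ℤ) → ℝ≥0∞} {x : Fin d → ℤ} {M : ℝ≥0∞}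
    (hM : ∀ x', nb 1 e x' ⊆ nb 4 e x → s x' ≤ M) : discretized e s x ≤ 3 ^ d * M := by
  rw [discretized_eq]
  refine (Finset.sum_le_card_nsmul _ _ M fun m hm => ?_).trans ?_
  · exact iSup₂_le fun h hh => hM _ (nb_subset_of_mem_tripleAtom (mem_tripleAtom.2 hm) hh)
  · rw [Fintype.card_piFinset]
    have : ∀ n : ℤ, n + 1 + 1 - (n - 1) = 3 := fun n => by ring
    simp [this]

/-- The overlap of the triples costs 3^d, hence 9^d for squares, and the radius of locality grows
from 1 to 4. From here on the shifts and the sets 3Q play no role. -/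
theorem ScaleOperators.discretized {a : ℕ → Fin d → ℕ} {ι : ℕ → ℝ≥0} {C : ℝ≥0}
    {T : ℕ → ((Fin d → ℤ) → ℂ) → (Fin d → ℤ) → ℝ≥0∞} (hT : ScaleOperators a ι C 1 T) :
    ScaleOperators a ι (9 ^ d * C) 4 fun k f => discretized (a k) (T k f) := by
  have hsq : ∀ k f x M, (∀ x', nb 1 (a k) x' ⊆ nb 4 (a k) x → T k f x' ^ 2 ≤ C * M) →
      ShiftedSquare.discretized (a k) (T k f) x ^ 2 ≤ ((9 ^ d * C : ℝ≥0) : ℝ≥0∞) * M := by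
    intro k f x M hM
    have h := discretized_le (e := a k) (s := T k f) (x := x) (M := (C * M) ^ (1 / 2 : ℝ))
      fun x' hx' => le_rpow_half_iff.2 (hM x' hx')
    calc _ ≤ (3 ^ d * (C * M) ^ (1 / 2 : ℝ)) ^ 2 := pow_le_pow_left' h 2
      _ = _ := by
        rw [mul_pow, rpow_half_sq, ← pow_mul, mul_comm d 2, pow_mul]
        push_cast
        ring
  refine ⟨fun k f g x h => ?_, fun k f g x => ?_, fun k f z x h => ?_, fun k f x => ?_,
    fun i k f h x hik hf hh => ?_⟩
  · simp only [discretized_eq]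
    refine Finset.sum_congr rfl fun m hm => ?_
    refine iSup_congr fun v => iSup_congr fun hv => hT.congr k f g _ fun y hy => h y ?_
    exact nb_subset_of_mem_tripleAtom (mem_tripleAtom.2 hm) hv hy
  · simp only [discretized_eq, ← Finset.sum_add_distrib]
    refine Finset.sum_le_sum fun m _ => iSup₂_le fun v hv => (hT.add_le k f g _).trans ?_
    exact add_le_add (le_iSup₂_of_le v hv le_rfl) (le_iSup₂_of_le v hv le_rfl)
  · refine le_antisymm ((discretized_le fun x' hx' =>
      (hT.const k f z x' fun y hy => h y (hx' hy)).le).trans ?_) zero_le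
    simp
  · refine hsq k f x _ fun x' hx' => (hT.sq_le k f x').trans ?_
    gcongr
  · refine hsq k f x _ fun x' hx' => (hT.cancel i k f h x' hik hf hh).trans ?_
    gcongr

/-! ### Cancellation away from boundaries. -/

theorem exists_mem_boundary {e : Fin d → ℕ} {G : Finset (Fin d → ℤ)} {p q : Fin d → ℤ}
    (hpq : atomIndex e p = atomIndex e q) (hp : p ∈ G) (hq : q ∉ G) :
    ∃ r, atomIndex e r = atomIndex e p ∧ r ∈ boundary G := by
  classical
  by_contra! hcon
  -- If the atom had no boundary point of `G`, membership in `G` would propagate along a lattice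
  -- path to `q`: a unit step in a coordinate where `r` and `q` differ stays in the box and lowers
  -- the ℓ¹ distance by one.
  have key : ∀ n : ℕ, ∀ r, atomIndex e r = atomIndex e p → r ∈ G →
      ∑ i, (r i - q i).natAbs = n → q ∈ G := by
    intro n
    induction n with
    | zero =>
      intro r _ hr hs
      have : r = q := by
        funext i
        have := (Finset.sum_eq_zero_iff.1 hs) i (Finset.mem_univ i)
        omega
      exact this ▸ hr
    | succ n ih =>
      intro r hrp hr hs
      obtain ⟨i, hi⟩ : ∃ i, r i ≠ q i := by
        by_contra! h
        simp [h] at hs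
      have hb := hcon r hrp
      simp only [boundary, Set.mem_ofPred_eq, not_and, not_exists, not_or, not_not] at hb
      have hnb := hb hr i
      have hrA := mem_atom'.1 (mem_atom.2 hrp)
      have hqA := mem_atom'.1 (mem_atom.2 hpq.symm)
      have step : ∀ s : ℤ, (s = 1 ∨ s = -1) → (r i + s - q i).natAbs + 1 = (r i - q i).natAbs →
          r + Pi.single i s ∈ G → q ∈ G := by
        intro s hs1 hs2 hG
        refine ih (r + Pi.single i s) ?_ hG ?_
        · rw [← mem_atom, mem_atom']
          intro j
          by_cases hj : j = i
          · subst hj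
            have := hrA j
            have := hqA j
            simp only [Pi.add_apply, Pi.single_eq_same]
            omega
          · simpa [hj] using hrA j
        · have h1 := Finset.add_sum_erase Finset.univ (fun j => (r j - q j).natAbs) (Finset.mem_univ i)
          have h2 := Finset.add_sum_erase Finset.univ
            (fun j => ((r + Pi.single i s : Fin d → ℤ) j - q j).natAbs) (Finset.mem_univ i)
          have h3 : ∑ j ∈ Finset.univ.erase i, ((r + Pi.single i s : Fin d → ℤ) j - q j).natAbs
              = ∑ j ∈ Finset.univ.erase i, (r j - q j).natAbs := by
            refine Finset.sum_congr rfl fun j hj => ?_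
            simp [Finset.ne_of_mem_erase hj]
          simp only [Pi.add_apply] at h3
          simp only [Pi.add_apply, Pi.single_eq_same] at h2 ⊢
          omega
      rcases lt_or_gt_of_ne hi with h | h
      · exact step 1 (Or.inl rfl) (by omega) hnb.1
      · refine step (-1) (Or.inr rfl) (by omega) ?_
        rw [Pi.single_neg, ← sub_eq_add_neg]
        exact hnb.2
  exact hq (key _ p rfl hp rfl)

theorem finite_boundaryCount (E F : Finset (Fin d → ℤ)) :
    {x : Fin d → ℤ | ∃ h ∈ F, h - x ∈ boundary E}.Finite := by
  refine ((F.finite_toSet.prod E.finite_toSet).image fun p => p.1 - p.2).subset ?_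
  rintro x ⟨h, hF, hE, _⟩
  exact ⟨(h, h - x), ⟨hF, hE⟩, by simp⟩

/-- Translation by `x` injects `U` into the set counted by B(E, H): the vector from the boundary
point `r` to `z` joins two points of one atom, so it lies in `H e`. -/
theorem card_le_boundaryCount {e : Fin d → ℕ} {E U : Finset (Fin d → ℤ)} (x : Fin d → ℤ)
    (hU : ∀ z ∈ U, ∃ r, atomIndex e r = atomIndex e z ∧ x - r ∈ boundary E) :
    U.card ≤ boundaryCount E (H e) := by
  rw [boundaryCount, ← Set.ncard_coe_finset]
  refine Set.ncard_le_ncard_of_injOn (fun z => z - x) (fun z hz => ?_)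
    (fun z _ w _ h => sub_left_injective h) (finite_boundaryCount E (H e))
  obtain ⟨r, hr, hrE⟩ := hU z hz
  refine ⟨z - r, ?_, ?_⟩
  · simp only [symBox, Fintype.mem_piFinset, Finset.mem_Ico]
    intro i
    have := abs_lt.1 (abs_sub_lt_of_atomIndex_eq hr.symm i)
    simp only [Pi.sub_apply, Nat.cast_one, one_mul]
    omega
  · convert hrE using 1
    abel

theorem mem_boundary_of_image {E : Finset (Fin d → ℤ)} {x r : Fin d → ℤ} [DecidableEq (Fin d → ℤ)]
    (h : r ∈ boundary (E.image fun y => x - y)) : x - r ∈ boundary E := by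
  have key : ∀ z, z ∈ E.image (fun y => x - y) ↔ x - z ∈ E := by
    intro z
    rw [Finset.mem_image]
    exact ⟨by rintro ⟨y, hy, rfl⟩; simpa using hy, fun h => ⟨_, h, by simp⟩⟩
  obtain ⟨h1, i, h2⟩ := h
  refine ⟨(key r).1 h1, i, ?_⟩
  rw [key, key, sub_add_eq_sub_sub, ← sub_add] at h2
  exact h2.symm

/-- The sum of a function of mean zero on the atoms over a difference of nested sets only sees the
atoms that meet the boundaries. -/
theorem sq_sum_sdiff_le {e : Fin d → ℕ} {f : (Fin d → ℤ) → ℂ} {h : (Fin d → ℤ) → ℝ≥0∞}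
    (hf : MeanZero e f) (hh : IsMajorant e f h) (E F : Finset (Fin d → ℤ)) (x : Fin d → ℤ) :
    ‖∑ y ∈ F \ E, f (x - y)‖ₑ ^ 2 ≤
      (boundaryCount E (H e) + boundaryCount F (H e) : ℕ) * ∑ y ∈ F \ E, h (x - y) := by
  classical
  set R : Finset (Fin d → ℤ) → Finset (Fin d → ℤ) := fun G => G.image fun y => x - y with hR
  have hmem : ∀ G z, z ∈ R G ↔ x - z ∈ G := by
    intro G z
    rw [hR, Finset.mem_image]
    exact ⟨by rintro ⟨y, hy, rfl⟩; simpa using hy, fun h => ⟨_, h, by simp⟩⟩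
  have hsum : ∀ {M : Type} [AddCommMonoid M] (φ : (Fin d → ℤ) → M),
      ∑ y ∈ F \ E, φ (x - y) = ∑ z ∈ R (F \ E), φ z := fun φ =>
    (Finset.sum_image fun _ _ _ _ h => sub_right_injective h).symm
  rw [hsum, hsum]
  set S := R (F \ E) with hS
  -- `U` collects the atoms that meet both `S` and its complement; the rest of `S` consists of whole
  -- atoms, on which `f` sums to zero.
  set U := (S.biUnion fun z => atom e (atomIndex e z)).filter
    fun z => ∃ w, atomIndex e w = atomIndex e z ∧ w ∉ S with hUdef
  have hmemU : ∀ z, z ∈ U ↔ (∃ w ∈ S, atomIndex e z = atomIndex e w) ∧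
      ∃ w, atomIndex e w = atomIndex e z ∧ w ∉ S := by
    intro z
    simp only [hUdef, Finset.mem_filter, Finset.mem_biUnion, mem_atom]
  have hU : IsUnionOfAtoms e U := by
    intro z z' hz hzz'
    rw [hmemU] at hz ⊢
    rwa [← hzz']
  have hSU : IsUnionOfAtoms e (S \ U) := by
    intro z z' hz hzz'
    rw [Finset.mem_sdiff] at hz ⊢
    have : z' ∈ S := by
      by_contra hcon
      exact hz.2 ((hmemU z).2 ⟨⟨z, hz.1, rfl⟩, z', hzz'.symm, hcon⟩)
    exact ⟨this, fun h => hz.2 (hU z' z h hzz'.symm)⟩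
  have hcard : U.card ≤ boundaryCount E (H e) + boundaryCount F (H e) := by
    have hsub : U ⊆ (U.filter fun z => ∃ r, atomIndex e r = atomIndex e z ∧ x - r ∈ boundary E) ∪
        (U.filter fun z => ∃ r, atomIndex e r = atomIndex e z ∧ x - r ∈ boundary F) := by
      intro z hz
      obtain ⟨⟨p, hpS, hp⟩, q, hq, hqS⟩ := (hmemU z).1 hz
      rw [Finset.mem_union, Finset.mem_filter (s := U), Finset.mem_filter (s := U)]
      rw [hS, hmem, Finset.mem_sdiff] at hpS hqS
      -- The atom leaves `F \ E` either by entering `E`, and then meets the boundary of `E`, or by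
      -- leaving `F`, and then meets the boundary of `F`.
      by_cases hqF : x - q ∈ F
      · have hqE : x - q ∈ E := by
          by_contra hcon
          exact hqS ⟨hqF, hcon⟩
        obtain ⟨r, hr, hrb⟩ := exists_mem_boundary (e := e) (G := R E) (p := q) (q := p)
          (hq.trans hp) ((hmem _ _).2 hqE) (fun h => hpS.2 ((hmem _ _).1 h))
        exact Or.inl ⟨hz, r, hr.trans hq, mem_boundary_of_image hrb⟩
      · obtain ⟨r, hr, hrb⟩ := exists_mem_boundary (e := e) (G := R F) (p := p) (q := q)
          (hq.trans hp).symm ((hmem _ _).2 hpS.1) (fun h => hqF ((hmem _ _).1 h))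
        exact Or.inr ⟨hz, r, hr.trans hp.symm, mem_boundary_of_image hrb⟩
    refine (Finset.card_le_card hsub).trans ((Finset.card_union_le _ _).trans (add_le_add ?_ ?_))
    · exact card_le_boundaryCount x fun z hz => (Finset.mem_filter.1 hz).2
    · exact card_le_boundaryCount x fun z hz => (Finset.mem_filter.1 hz).2
  have hsplit : ∑ z ∈ S, f z = ∑ z ∈ S ∩ U, f z := by
    rw [← Finset.sum_inter_add_sum_sdiff S U f, hf.sum_eq_zero hSU, add_zero]
  rw [hsplit]
  calc ‖∑ z ∈ S ∩ U, f z‖ₑ ^ 2 ≤ (∑ z ∈ S ∩ U, ‖f z‖ₑ) ^ 2 := by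
        gcongr
        exact enorm_sum_le _ _
    _ ≤ U.card * ∑ y ∈ S, h y := hh S U hU
    _ ≤ _ := by gcongr

theorem boundaryCount_empty (F : Finset (Fin d → ℤ)) : boundaryCount ∅ F = 0 := by
  simp [boundaryCount, boundary]

/-! ### Convolution averages and dyadic expectations. -/

theorem sq_norm_sum_le_card (f : (Fin d → ℤ) → ℂ) (G : Finset (Fin d → ℤ)) (x : Fin d → ℤ) :
    ‖∑ y ∈ G, f (x - y)‖ₑ ^ 2 ≤ G.card * ∑ y ∈ G, ‖f (x - y)‖ₑ ^ 2 :=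
  (pow_le_pow_left' (enorm_sum_le _ _) 2).trans (sq_sum_le_card_mul _ _)

theorem sum_sdiff_telescope {M : Type*} [AddCommMonoid M] (φ : (Fin d → ℤ) → M)
    (G : ℕ → Finset (Fin d → ℤ)) (n : ℕ) (hG : ∀ i < n, G i ⊆ G (i + 1)) :
    ∑ i ∈ Finset.range n, ∑ y ∈ G (i + 1) \ G i, φ y + ∑ y ∈ G 0, φ y = ∑ y ∈ G n, φ y := by
  induction n with
  | zero => simp
  | succ n ih =>
    rw [Finset.sum_range_succ, add_right_comm, ih fun i hi => hG i (by omega), add_comm,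
      Finset.sum_sdiff (hG n (by omega))]

theorem enorm_inv_natCast {n : ℕ} (hn : n ≠ 0) : ‖(n : ℂ)⁻¹‖ₑ = (n : ℝ≥0∞)⁻¹ := by
  rw [enorm_inv (by exact_mod_cast hn)]
  congr 1
  rw [← ofReal_norm, Complex.norm_natCast, ENNReal.ofReal_natCast]

/-- The two terms are the change of normalization and the newly added points. Both involve only the
increment `F \ E`, so they can be summed along a nested sequence. -/
theorem convAverage_sub (f : (Fin d → ℤ) → ℂ) {E F : Finset (Fin d → ℤ)} (hEF : E ⊆ F)
    (hE : E.card ≠ 0) (x : Fin d → ℤ) :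
    convAverage E f x - convAverage F f x =
      (E.card : ℂ)⁻¹ * ((F \ E).card * (F.card : ℂ)⁻¹) * ∑ y ∈ E, f (x - y) -
        (F.card : ℂ)⁻¹ * ∑ y ∈ F \ E, f (x - y) := by
  have hF : F.card ≠ 0 := by
    have := Finset.card_le_card hEF
    omega
  have hE' : (E.card : ℂ) ≠ 0 := by exact_mod_cast hE
  have hF' : (F.card : ℂ) ≠ 0 := by exact_mod_cast hF
  have h : ((F \ E).card : ℂ) = F.card - E.card := by
    rw [Finset.card_sdiff_of_subset hEF, Nat.cast_sub (Finset.card_le_card hEF)]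
  rw [convAverage, convAverage, h, ← Finset.sum_sdiff hEF]
  field_simp
  ring

/-- The ratio |F \ E| / |F| is at most 1, so its square is bounded by its first power; a bound
linear in the size of the increment telescopes. -/
theorem sq_norm_convAverage_sub_le (f : (Fin d → ℤ) → ℂ) {E F : Finset (Fin d → ℤ)} (hEF : E ⊆ F)
    (x : Fin d → ℤ) {μ : ℝ≥0∞} (hE0 : E.card ≠ 0) (hE : (E.card : ℝ≥0∞)⁻¹ ≤ μ) :
    ‖convAverage E f x - convAverage F f x‖ₑ ^ 2 ≤
      2 * (μ ^ 3 * (F \ E).card * ‖∑ y ∈ E, f (x - y)‖ₑ ^ 2) +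
        2 * (μ ^ 2 * ‖∑ y ∈ F \ E, f (x - y)‖ₑ ^ 2) := by
  have hcard := Finset.card_le_card hEF
  have hF0 : F.card ≠ 0 := by omega
  have hF : (F.card : ℝ≥0∞)⁻¹ ≤ μ := le_trans (by gcongr) hE
  have hr : ((F \ E).card : ℝ≥0∞) * (F.card : ℝ≥0∞)⁻¹ ≤ 1 := by
    rw [← div_eq_mul_inv]
    refine ENNReal.div_le_of_le_mul ?_
    rw [one_mul]
    exact_mod_cast Finset.card_le_card Finset.sdiff_subset
  have hr' : (((F \ E).card : ℝ≥0∞) * (F.card : ℝ≥0∞)⁻¹) ^ 2 ≤ (F \ E).card * μ := by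
    calc (((F \ E).card : ℝ≥0∞) * (F.card : ℝ≥0∞)⁻¹) ^ 2
        ≤ ((F \ E).card : ℝ≥0∞) * (F.card : ℝ≥0∞)⁻¹ := pow_le_of_le_one zero_le hr two_ne_zero
      _ ≤ _ := by gcongr
  rw [convAverage_sub f hEF hE0]
  calc _ ≤ (‖(E.card : ℂ)⁻¹ * ((F \ E).card * (F.card : ℂ)⁻¹) * ∑ y ∈ E, f (x - y)‖ₑ +
        ‖(F.card : ℂ)⁻¹ * ∑ y ∈ F \ E, f (x - y)‖ₑ) ^ 2 := by
        gcongr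
        exact enorm_sub_le
    _ ≤ _ := add_sq_le_two _ _
    _ ≤ _ := by
        rw [enorm_mul, enorm_mul, enorm_mul, enorm_mul, enorm_inv_natCast hE0,
          enorm_inv_natCast hF0]
        have : ‖((F \ E).card : ℂ)‖ₑ = ((F \ E).card : ℝ≥0∞) := by
          rw [← ofReal_norm, Complex.norm_natCast, ENNReal.ofReal_natCast]
        rw [this, mul_pow ((E.card : ℝ≥0∞)⁻¹ * _),
          mul_pow ((E.card : ℝ≥0∞)⁻¹)]
        gcongr 2 * (?_ * _) + 2 * ?_
        swap
        · rw [mul_pow]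
          gcongr
        calc ((E.card : ℝ≥0∞)⁻¹) ^ 2 * (((F \ E).card : ℝ≥0∞) * (F.card : ℝ≥0∞)⁻¹) ^ 2
            ≤ μ ^ 2 * ((F \ E).card * μ) := by gcongr
          _ = _ := by ring

theorem sum_sub_le_sum_nb {e : Fin d → ℕ} {G : Finset (Fin d → ℤ)} (hG : G ⊆ H e)
    (h : (Fin d → ℤ) → ℝ≥0∞) (x : Fin d → ℤ) : ∑ y ∈ G, h (x - y) ≤ ∑ y ∈ nb 1 e x, h y := by
  classical
  rw [← Finset.sum_image (s := G) (g := fun y => x - y) (f := h) fun _ _ _ _ h => sub_right_injective h]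
  refine Finset.sum_le_sum_of_subset fun z hz => ?_
  obtain ⟨y, hy, rfl⟩ := Finset.mem_image.1 hz
  have := hG hy
  simp only [symBox, Fintype.mem_piFinset, Finset.mem_Ico] at this
  rw [mem_nb]
  intro i
  have := this i
  simp only [Pi.sub_apply, sub_sub_cancel_left, abs_neg, abs_le]
  omega

theorem sub_mem_nb {e : Fin d → ℕ} {y : Fin d → ℤ} (hy : y ∈ H e) (x : Fin d → ℤ) :
    x - y ∈ nb 1 e x := by
  simp only [symBox, Fintype.mem_piFinset, Finset.mem_Ico] at hy
  rw [mem_nb]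
  intro i
  have := hy i
  simp only [Pi.sub_apply, sub_sub_cancel_left, abs_neg, abs_le]
  omega

theorem atom_subset_nb (e : Fin d → ℕ) (x : Fin d → ℤ) : atom e (atomIndex e x) ⊆ nb 1 e x := by
  intro y hy
  rw [mem_nb]
  intro i
  have := abs_sub_lt_of_atomIndex_eq (mem_atom.1 hy) i
  simp only [Nat.cast_one, one_mul]
  exact this.le

theorem convAverage_congr {e : Fin d → ℕ} {E : Finset (Fin d → ℤ)} (hE : E ⊆ H e)
    {f g : (Fin d → ℤ) → ℂ} {x : Fin d → ℤ} (h : ∀ y ∈ nb 1 e x, f y = g y) :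
    convAverage E f x = convAverage E g x := by
  rw [convAverage, convAverage]
  congr 1
  exact Finset.sum_congr rfl fun y hy => h _ (sub_mem_nb (hE hy) x)

theorem convAverage_const {e : Fin d → ℕ} {E : Finset (Fin d → ℤ)} (hE : E ⊆ H e)
    (hE0 : E.card ≠ 0) {f : (Fin d → ℤ) → ℂ} {x : Fin d → ℤ} {z : ℂ}
    (h : ∀ y ∈ nb 1 e x, f y = z) : convAverage E f x = z := by
  have h0 : (E.card : ℂ) ≠ 0 := by exact_mod_cast hE0
  rw [convAverage, Finset.sum_congr rfl fun y hy => h _ (sub_mem_nb (hE hy) x), Finset.sum_const,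
    nsmul_eq_mul, inv_mul_cancel_left₀ h0]

theorem convAverage_add (E : Finset (Fin d → ℤ)) (f g : (Fin d → ℤ) → ℂ) (x : Fin d → ℤ) :
    convAverage E (f + g) x = convAverage E f x + convAverage E g x := by
  simp only [convAverage, Pi.add_apply, Finset.sum_add_distrib, mul_add]

theorem dyadicExpectation_congr {e : Fin d → ℕ} {f g : (Fin d → ℤ) → ℂ} {x : Fin d → ℤ}
    (h : ∀ y ∈ nb 1 e x, f y = g y) : dyadicExpectation e f x = dyadicExpectation e g x := by
  rw [dyadicExpectation, dyadicExpectation]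
  congr 1
  exact Finset.sum_congr rfl fun y hy => h _ (atom_subset_nb e x hy)

theorem dyadicExpectation_const {e : Fin d → ℕ} {f : (Fin d → ℤ) → ℂ} {x : Fin d → ℤ} {z : ℂ}
    (h : ∀ y ∈ nb 1 e x, f y = z) : dyadicExpectation e f x = z := by
  have h0 : ((atom e (atomIndex e x)).card : ℂ) ≠ 0 := by
    rw [card_atom]
    exact_mod_cast (vol_pos e).ne'
  rw [dyadicExpectation, Finset.sum_congr rfl fun y hy => h y (atom_subset_nb e x hy),
    Finset.sum_const, nsmul_eq_mul, inv_mul_cancel_left₀ h0]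

theorem dyadicExpectation_add (e : Fin d → ℕ) (f g : (Fin d → ℤ) → ℂ) (x : Fin d → ℤ) :
    dyadicExpectation e (f + g) x = dyadicExpectation e f x + dyadicExpectation e g x := by
  simp only [dyadicExpectation, Pi.add_apply, Finset.sum_add_distrib, mul_add]

theorem sq_norm_dyadicExpectation_le (e : Fin d → ℕ) (f : (Fin d → ℤ) → ℂ) (x : Fin d → ℤ) :
    ‖dyadicExpectation e f x‖ₑ ^ 2 ≤
      (vol e : ℝ≥0∞)⁻¹ * ∑ y ∈ atom e (atomIndex e x), ‖f y‖ₑ ^ 2 := by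
  rw [dyadicExpectation, card_atom, enorm_mul, enorm_inv_natCast (vol_pos e).ne', mul_pow]
  calc _ ≤ (vol e : ℝ≥0∞)⁻¹ ^ 2 * (∑ y ∈ atom e (atomIndex e x), ‖f y‖ₑ) ^ 2 := by
        gcongr
        exact enorm_sum_le _ _
    _ ≤ (vol e : ℝ≥0∞)⁻¹ ^ 2 * (vol e * ∑ y ∈ atom e (atomIndex e x), ‖f y‖ₑ ^ 2) := by
        gcongr
        exact (sq_sum_le_card_mul _ _).trans (by rw [card_atom])
    _ = (vol e * (vol e : ℝ≥0∞)⁻¹) *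
          ((vol e : ℝ≥0∞)⁻¹ * ∑ y ∈ atom e (atomIndex e x), ‖f y‖ₑ ^ 2) := by ring
    _ = _ := by rw [vol_mul_inv, one_mul]

theorem card_H_ne_zero (e : Fin d → ℕ) : (((H e).card : ℕ) : ℝ≥0∞) ≠ 0 := by
  rw [card_symBox]
  have := vol_pos e
  exact_mod_cast (by positivity : 0 < (2 * 1) ^ d * vol e).ne'

theorem inv_card_H_le (e : Fin d → ℕ) : (((H e).card : ℕ) : ℝ≥0∞)⁻¹ ≤ (vol e : ℝ≥0∞)⁻¹ := by
  rw [card_symBox, ENNReal.inv_le_inv]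
  exact_mod_cast Nat.le_mul_of_pos_left _ (by positivity)

/-- The parameter `θ` lets one computation give both the ℓ² bound (`θ = 1`) and the cancellation
bound (`θ` a multiple of `ι ^ 2`). -/
theorem sq_norm_convAverage_le {e : Fin d → ℕ} {f : (Fin d → ℤ) → ℂ} {h : (Fin d → ℤ) → ℝ≥0∞}
    {x : Fin d → ℤ} {D θ : ℝ≥0∞} {F : Finset (Fin d → ℤ)} (hF : F ⊆ H e) (hF0 : F.card ≠ 0)
    (hD : (F.card : ℝ≥0∞)⁻¹ ≤ D * ((H e).card : ℝ≥0∞)⁻¹)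
    (hB : ‖∑ y ∈ F, f (x - y)‖ₑ ^ 2 ≤ θ * (H e).card * ∑ y ∈ F, h (x - y)) :
    ‖convAverage F f x‖ₑ ^ 2 ≤ D ^ 2 * θ * ((vol e : ℝ≥0∞)⁻¹ * ∑ y ∈ nb 1 e x, h y) := by
  rw [convAverage, enorm_mul, enorm_inv_natCast hF0, mul_pow]
  set N : ℝ≥0∞ := ((H e).card : ℝ≥0∞) with hN
  have hNN : N * N⁻¹ = 1 := ENNReal.mul_inv_cancel (card_H_ne_zero e) (ENNReal.natCast_ne_top _)
  calc _ ≤ (D * N⁻¹) ^ 2 * (θ * N * ∑ y ∈ nb 1 e x, h y) := by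
        gcongr
        refine hB.trans ?_
        gcongr
        exact sum_sub_le_sum_nb hF h x
    _ = D ^ 2 * θ * ((N * N⁻¹) * N⁻¹ * ∑ y ∈ nb 1 e x, h y) := by ring
    _ ≤ _ := by
        rw [hNN, one_mul]
        have := inv_card_H_le e
        rw [← hN] at this
        gcongr _ * (?_ * _)

/-- The increments are disjoint and lie in `H e`, so their cardinalities and their sums of `h` add
up to at most those of one box; nothing depends on `n`. -/
theorem sum_sq_norm_convAverage_sub_le {e : Fin d → ℕ} {f : (Fin d → ℤ) → ℂ}
    {h : (Fin d → ℤ) → ℝ≥0∞} {x : Fin d → ℤ} {D θ : ℝ≥0∞} {n : ℕ} {G : ℕ → Finset (Fin d → ℤ)}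
    (hG : ∀ i ≤ n, G i ⊆ H e) (hG0 : ∀ i ≤ n, (G i).card ≠ 0)
    (hmono : ∀ i < n, G i ⊆ G (i + 1))
    (hD : ∀ i ≤ n, ((G i).card : ℝ≥0∞)⁻¹ ≤ D * ((H e).card : ℝ≥0∞)⁻¹)
    (hB : ∀ i ≤ n, ‖∑ y ∈ G i, f (x - y)‖ₑ ^ 2 ≤ θ * (H e).card * ∑ y ∈ G i, h (x - y))
    (hB' : ∀ i < n, ‖∑ y ∈ G (i + 1) \ G i, f (x - y)‖ₑ ^ 2 ≤
      θ * (H e).card * ∑ y ∈ G (i + 1) \ G i, h (x - y)) :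
    ∑ i ∈ Finset.range n, ‖convAverage (G i) f x - convAverage (G (i + 1)) f x‖ₑ ^ 2 ≤
      (2 * D ^ 3 + 2 * D ^ 2) * θ * ((vol e : ℝ≥0∞)⁻¹ * ∑ y ∈ nb 1 e x, h y) := by
  set N : ℝ≥0∞ := ((H e).card : ℝ≥0∞) with hN
  set Sh := ∑ y ∈ nb 1 e x, h y with hSh
  have hNN : N * N⁻¹ = 1 := ENNReal.mul_inv_cancel (card_H_ne_zero e) (ENNReal.natCast_ne_top _)
  have htel : ∀ φ : (Fin d → ℤ) → ℝ≥0∞,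
      ∑ i ∈ Finset.range n, ∑ y ∈ G (i + 1) \ G i, φ y ≤ ∑ y ∈ G n, φ y := by
    intro φ
    rw [← sum_sdiff_telescope φ G n hmono]
    exact le_self_add
  have h1 : ∑ i ∈ Finset.range n, ((G (i + 1) \ G i).card : ℝ≥0∞) ≤ N := by
    have := htel fun _ => 1
    simp only [Finset.sum_const, nsmul_eq_mul, mul_one] at this
    refine this.trans ?_
    rw [hN]
    exact_mod_cast Finset.card_le_card (hG n le_rfl)
  have h2 : ∑ i ∈ Finset.range n, ∑ y ∈ G (i + 1) \ G i, h (x - y) ≤ Sh :=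
    (htel fun y => h (x - y)).trans (sum_sub_le_sum_nb (hG n le_rfl) h x)
  calc _ ≤ ∑ i ∈ Finset.range n, (2 * ((D * N⁻¹) ^ 3 * (G (i + 1) \ G i).card * (θ * N * Sh)) +
        2 * ((D * N⁻¹) ^ 2 * (θ * N * ∑ y ∈ G (i + 1) \ G i, h (x - y)))) := by
        refine Finset.sum_le_sum fun i hi => ?_
        have hi := Finset.mem_range.1 hi
        refine (sq_norm_convAverage_sub_le f (hmono i hi) x (hG0 i hi.le) (hD i hi.le)).trans ?_
        gcongr
        · refine (hB i hi.le).trans ?_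
          gcongr
          exact sum_sub_le_sum_nb (hG i hi.le) h x
        · exact hB' i hi
    _ = 2 * (D * N⁻¹) ^ 3 * (θ * N * Sh) * ∑ i ∈ Finset.range n, ((G (i + 1) \ G i).card : ℝ≥0∞) +
        2 * (D * N⁻¹) ^ 2 * (θ * N) *
          ∑ i ∈ Finset.range n, ∑ y ∈ G (i + 1) \ G i, h (x - y) := by
        rw [Finset.sum_add_distrib, Finset.mul_sum (Finset.range n), Finset.mul_sum (Finset.range n)]
        congr 1 <;> refine Finset.sum_congr rfl fun i _ => ?_ <;> ring
    _ ≤ 2 * (D * N⁻¹) ^ 3 * (θ * N * Sh) * N + 2 * (D * N⁻¹) ^ 2 * (θ * N) * Sh := by gcongr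
    _ = 2 * D ^ 3 * θ * ((N * N⁻¹) * (N * N⁻¹) * N⁻¹ * Sh) +
        2 * D ^ 2 * θ * ((N * N⁻¹) * N⁻¹ * Sh) := by ring
    _ = (2 * D ^ 3 + 2 * D ^ 2) * θ * (N⁻¹ * Sh) := by rw [hNN]; ring
    _ ≤ _ := by
        have := inv_card_H_le e
        rw [← hN] at this
        gcongr _ * (?_ * _)

/-! ### The long and short square functions satisfy the abstract properties. -/

section

variable {c : ℝ} {ι ε : ℕ → ℝ≥0} {a : ℕ → Fin d → ℕ} {𝒜 : ℕ → Set (Finset (Fin d → ℤ))}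

theorem JRWCriteria.card_ne_zero (hA : JRWCriteria c ι ε a 𝒜) (hc : 0 < c) {k : ℕ}
    {E : Finset (Fin d → ℤ)} (hE : E ∈ 𝒜 k) : E.card ≠ 0 := by
  intro h
  have h1 := hA.size k E hE
  have h2 : ((H (a k)).card : ℝ) > 0 := by
    have := card_H_ne_zero (a k)
    have h3 : (H (a k)).card ≠ 0 := by exact_mod_cast this
    positivity
  rw [h] at h1
  have := mul_pos hc h2
  simp at h1
  linarith

theorem JRWCriteria.inv_card_le (hA : JRWCriteria c ι ε a 𝒜) (hc : 0 < c) {k : ℕ}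
    {E : Finset (Fin d → ℤ)} (hE : E ∈ 𝒜 k) :
    (E.card : ℝ≥0∞)⁻¹ ≤ (c.toNNReal⁻¹ : ℝ≥0) * ((H (a k)).card : ℝ≥0∞)⁻¹ := by
  have hc' : c.toNNReal ≠ 0 := by simpa using hc
  have hc'' : (c.toNNReal : ℝ≥0∞) ≠ 0 := by exact_mod_cast hc'
  rw [ENNReal.coe_inv hc', ← ENNReal.mul_inv (Or.inl hc'') (Or.inl ENNReal.coe_ne_top),
    ENNReal.inv_le_inv]
  have h1 := hA.size k E hE
  have h2 : c.toNNReal * ((H (a k)).card : ℝ≥0) ≤ E.card := by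
    rw [← NNReal.coe_le_coe]
    push_cast
    rwa [Real.coe_toNNReal c hc.le]
  exact_mod_cast h2

theorem JRWCriteria.boundaryCount_le (hA : JRWCriteria c ι ε a 𝒜) {i k : ℕ} (hik : i ≤ k)
    {E : Finset (Fin d → ℤ)} (hE : E ∈ 𝒜 k) :
    (boundaryCount E (H (a i)) : ℝ≥0∞) ≤ (ι (k - i) : ℝ≥0∞) ^ 2 * (H (a k)).card := by
  obtain ⟨l, rfl⟩ := Nat.exists_eq_add_of_le hik
  have h1 := hA.smoothness i l E hE
  have h3 : (H (a (i + l))).card ≠ 0 := by exact_mod_cast card_H_ne_zero (a (i + l))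
  rw [div_le_iff₀ (by positivity)] at h1
  rw [Nat.add_sub_cancel_left]
  have h2 : (boundaryCount E (H (a i)) : ℝ≥0) ≤ ι l ^ 2 * (H (a (i + l))).card := by
    exact_mod_cast h1
  exact_mod_cast h2

/-- The case `E = ∅` covers a single averaging set, the other case an increment. The factor 2
accounts for two boundaries. -/
theorem JRWCriteria.sq_sum_le (hA : JRWCriteria c ι ε a 𝒜) {i k : ℕ} (hik : i ≤ k)
    {E F : Finset (Fin d → ℤ)} (hE : E = ∅ ∨ E ∈ 𝒜 k) (hF : F ∈ 𝒜 k) {f : (Fin d → ℤ) → ℂ}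
    {h : (Fin d → ℤ) → ℝ≥0∞} (hf : MeanZero (a i) f) (hh : IsMajorant (a i) f h) (x : Fin d → ℤ) :
    ‖∑ y ∈ F \ E, f (x - y)‖ₑ ^ 2 ≤
      2 * (ι (k - i) : ℝ≥0∞) ^ 2 * (H (a k)).card * ∑ y ∈ F \ E, h (x - y) := by
  refine (sq_sum_sdiff_le hf hh E F x).trans ?_
  gcongr
  have h1 : (boundaryCount E (H (a i)) : ℝ≥0∞) ≤ (ι (k - i) : ℝ≥0∞) ^ 2 * (H (a k)).card := by
    rcases hE with rfl | hE
    · simp [boundaryCount_empty]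
    · exact hA.boundaryCount_le hik hE
  push_cast
  calc _ ≤ _ := add_le_add h1 (hA.boundaryCount_le hik hF)
    _ = _ := by ring

theorem JRWCriteria.sq_sum_le' (hA : JRWCriteria c ι ε a 𝒜) {k : ℕ}
    {G F : Finset (Fin d → ℤ)} (hF : F ∈ 𝒜 k) (hG : G ⊆ F) (f : (Fin d → ℤ) → ℂ) (x : Fin d → ℤ) :
    ‖∑ y ∈ G, f (x - y)‖ₑ ^ 2 ≤ 1 * (H (a k)).card * ∑ y ∈ G, ‖f (x - y)‖ₑ ^ 2 := by
  refine (sq_norm_sum_le_card f _ x).trans ?_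
  rw [one_mul]
  gcongr
  exact hG.trans (hA.location k F hF)

/-- The constant that controls the parts of the square functions at one scale. -/
def scaleConst (c : ℝ) : ℝ≥0 := 4 * c.toNNReal⁻¹ ^ 3 + 4 * c.toNNReal⁻¹ ^ 2 + 2

theorem scaleOperators_longPart (hA : JRWCriteria c ι ε a 𝒜) (hc : 0 < c) (ha : Monotone a)
    {E : ℕ → Finset (Fin d → ℤ)} (hE : IsRegular 𝒜 E) :
    ScaleOperators a ι (scaleConst c) 1 (longPart a E) := by
  have hmem : ∀ {k t : ℕ}, t ∈ Set.Ico (2 ^ k) (2 ^ (k + 1)) → E t ∈ 𝒜 k := fun {k t} ht =>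
    (hE k t t ht.1 le_rfl ht.2).2.1
  set D : ℝ≥0 := c.toNNReal⁻¹ with hDdef
  have hC : (scaleConst c : ℝ≥0∞) = 4 * (D : ℝ≥0∞) ^ 3 + 4 * (D : ℝ≥0∞) ^ 2 + 2 := by
    rw [scaleConst]; push_cast; rfl
  have hsq : ∀ {k : ℕ} {f x} {M : ℝ≥0∞}, (∀ t ∈ Set.Ico (2 ^ k) (2 ^ (k + 1)),
      ‖convAverage (E t) f x - dyadicExpectation (a k) f x‖ₑ ^ 2 ≤ M) →
      longPart a E k f x ^ 2 ≤ M := by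
    intro k f x M h
    rw [← le_rpow_half_iff]
    exact iSup₂_le fun t ht => le_rpow_half_iff.2 (h t ht)
  refine ⟨fun k f g x h => ?_, fun k f g x => ?_, fun k f z x h => ?_, fun k f x => ?_,
    fun i k f h x hik hf hh => ?_⟩
  · refine iSup_congr fun t => iSup_congr fun ht => ?_
    rw [convAverage_congr (hA.location k _ (hmem ht)) h, dyadicExpectation_congr h]
  · refine iSup₂_le fun t ht => ?_
    rw [convAverage_add, dyadicExpectation_add, add_sub_add_comm]
    exact (enorm_add_le _ _).trans (add_le_add
      (le_iSup₂ (f := fun t _ => ‖convAverage (E t) f x - dyadicExpectation (a k) f x‖ₑ) t ht)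
      (le_iSup₂ (f := fun t _ => ‖convAverage (E t) g x - dyadicExpectation (a k) g x‖ₑ) t ht))
  · refine le_antisymm (iSup₂_le fun t ht => ?_) zero_le
    rw [convAverage_const (hA.location k _ (hmem ht)) (hA.card_ne_zero hc (hmem ht)) h,
      dyadicExpectation_const h]
    simp
  · refine hsq fun t ht => ?_
    have h1 := sq_norm_convAverage_le (hA.location k _ (hmem ht)) (hA.card_ne_zero hc (hmem ht))
      (hA.inv_card_le hc (hmem ht)) (h := fun y => ‖f y‖ₑ ^ 2)
      (hA.sq_sum_le' (hmem ht) subset_rfl f x)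
    have h2 : ‖dyadicExpectation (a k) f x‖ₑ ^ 2 ≤
        (vol (a k) : ℝ≥0∞)⁻¹ * ∑ y ∈ nb 1 (a k) x, ‖f y‖ₑ ^ 2 := by
      refine (sq_norm_dyadicExpectation_le _ f x).trans ?_
      gcongr
      exact atom_subset_nb _ x
    calc _ ≤ (‖convAverage (E t) f x‖ₑ + ‖dyadicExpectation (a k) f x‖ₑ) ^ 2 := by
          gcongr
          exact enorm_sub_le
      _ ≤ _ := add_sq_le_two _ _
      _ ≤ _ := add_le_add (mul_le_mul_right h1 2) (mul_le_mul_right h2 2)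
      _ = (2 * (D : ℝ≥0∞) ^ 2 + 2) *
          ((vol (a k) : ℝ≥0∞)⁻¹ * ∑ y ∈ nb 1 (a k) x, ‖f y‖ₑ ^ 2) := by ring
      _ ≤ _ := by
          rw [hC]
          gcongr
          calc 2 * (D : ℝ≥0∞) ^ 2 ≤ 4 * (D : ℝ≥0∞) ^ 2 := by gcongr; norm_num
            _ ≤ _ := le_add_self
  · refine hsq fun t ht => ?_
    -- Atoms of σ_k are unions of atoms of the finer σ_i, so only the convolution average survives.
    have h0 : dyadicExpectation (a k) f x = 0 := by
      rw [dyadicExpectation, hf.sum_eq_zero (isUnionOfAtoms_atom (ha hik) _), mul_zero]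
    have hB := hA.sq_sum_le hik (Or.inl rfl) (hmem ht) hf hh x
    rw [Finset.sdiff_empty] at hB
    have h1 := sq_norm_convAverage_le (hA.location k _ (hmem ht)) (hA.card_ne_zero hc (hmem ht))
      (hA.inv_card_le hc (hmem ht)) hB
    rw [h0, sub_zero]
    refine h1.trans ?_
    rw [← mul_assoc _ 2, mul_assoc _ (_ ^ 2), hC]
    gcongr ?_ * _
    calc (D : ℝ≥0∞) ^ 2 * 2 ≤ (D : ℝ≥0∞) ^ 2 * 4 := by gcongr; norm_num
      _ = 4 * (D : ℝ≥0∞) ^ 2 := mul_comm _ _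
      _ ≤ 4 * (D : ℝ≥0∞) ^ 3 + 4 * (D : ℝ≥0∞) ^ 2 := le_add_self
      _ ≤ _ := le_self_add

theorem scaleOperators_shortPart (hA : JRWCriteria c ι ε a 𝒜) (hc : 0 < c)
    {E : ℕ → Finset (Fin d → ℤ)} (hE : IsRegular 𝒜 E) :
    ScaleOperators a ι (scaleConst c) 1 (shortPart E) := by
  have hmem : ∀ {k t : ℕ}, t ∈ Set.Ico (2 ^ k) (2 ^ (k + 1)) → E t ∈ 𝒜 k := fun {k t} ht =>
    (hE k t t ht.1 le_rfl ht.2).2.1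
  set D : ℝ≥0 := c.toNNReal⁻¹ with hDdef
  have hC : (scaleConst c : ℝ≥0∞) = 4 * (D : ℝ≥0∞) ^ 3 + 4 * (D : ℝ≥0∞) ^ 2 + 2 := by
    rw [scaleConst]; push_cast; rfl
  have hsub : ∀ {k n : ℕ} {t : ℕ → ℕ}, StrictMonoOn t (Set.Iic n) →
      (∀ i ≤ n, t i ∈ Set.Ico (2 ^ k) (2 ^ (k + 1))) → ∀ i < n, E (t i) ⊆ E (t (i + 1)) :=
    fun {k n t} ht htk i hi => (hE k _ _ (htk i hi.le).1
      (ht (Set.mem_Iic.2 hi.le) (Set.mem_Iic.2 hi) (Nat.lt_succ_self i)).le (htk (i + 1) hi).2).1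
  have hsq : ∀ {k : ℕ} {f x} {M : ℝ≥0∞}, (∀ (n : ℕ) (t : ℕ → ℕ), StrictMonoOn t (Set.Iic n) →
      (∀ i ≤ n, t i ∈ Set.Ico (2 ^ k) (2 ^ (k + 1))) →
      ∑ i ∈ Finset.range n, ‖convAverage (E (t i)) f x - convAverage (E (t (i + 1))) f x‖ₑ ^ 2
        ≤ M) → shortPart E k f x ^ 2 ≤ M := by
    intro k f x M h
    rw [shortPart, rpow_half_sq]
    exact iSup_le fun n => iSup_le fun t => iSup_le fun ht => iSup_le fun htk => h n t ht htk
  have hle : ∀ {k : ℕ} {f x} {n : ℕ} {t : ℕ → ℕ}, StrictMonoOn t (Set.Iic n) →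
      (∀ i ≤ n, t i ∈ Set.Ico (2 ^ k) (2 ^ (k + 1))) →
      (∑ i ∈ Finset.range n,
        ‖convAverage (E (t i)) f x - convAverage (E (t (i + 1))) f x‖ₑ ^ (2 : ℝ)) ^ (1 / 2 : ℝ)
        ≤ shortPart E k f x := by
    intro k f x n t ht htk
    rw [shortPart]
    refine ENNReal.rpow_le_rpow ?_ (by norm_num)
    simp only [ENNReal.rpow_two]
    exact le_iSup_of_le n (le_iSup_of_le t (le_iSup_of_le ht (le_iSup_of_le htk le_rfl)))
  refine ⟨fun k f g x h => ?_, fun k f g x => ?_, fun k f z x h => ?_, fun k f x => ?_,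
    fun i k f h x hik hf hh => ?_⟩
  · rw [shortPart, shortPart]
    congr 1
    refine iSup_congr fun n => iSup_congr fun t => iSup_congr fun ht => iSup_congr fun htk =>
      Finset.sum_congr rfl fun i hi => ?_
    have hi := Finset.mem_range.1 hi
    rw [convAverage_congr (hA.location k _ (hmem (htk i hi.le))) h,
      convAverage_congr (hA.location k _ (hmem (htk (i + 1) hi))) h]
  · rw [← (ENNReal.pow_right_strictMono two_ne_zero).le_iff_le]
    refine hsq fun n t ht htk => ?_
    simp only [convAverage_add, add_sub_add_comm]
    rw [← rpow_half_sq (∑ i ∈ Finset.range n, _)]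
    refine pow_le_pow_left' ?_ 2
    refine le_trans ?_ (add_le_add (hle (f := f) ht htk) (hle (f := g) ht htk))
    -- Minkowski's inequality in ℓ² along the sequence of times.
    refine le_trans ?_ (ENNReal.Lp_add_le _ _ _ (by norm_num))
    simp only [ENNReal.rpow_two]
    gcongr
    exact enorm_add_le _ _
  · refine pow_eq_zero_iff two_ne_zero |>.1 (le_antisymm (hsq fun n t ht htk => ?_) zero_le)
    refine (Finset.sum_eq_zero fun i hi => ?_).le
    have hi := Finset.mem_range.1 hi
    rw [convAverage_const (hA.location k _ (hmem (htk i hi.le)))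
      (hA.card_ne_zero hc (hmem (htk i hi.le))) h,
      convAverage_const (hA.location k _ (hmem (htk (i + 1) hi)))
      (hA.card_ne_zero hc (hmem (htk (i + 1) hi))) h]
    simp
  · refine hsq fun n t ht htk => ?_
    refine (sum_sq_norm_convAverage_sub_le (h := fun y => ‖f y‖ₑ ^ 2) (D := D) (θ := 1)
      (fun i hi => hA.location k _ (hmem (htk i hi)))
      (fun i hi => hA.card_ne_zero hc (hmem (htk i hi))) (hsub ht htk)
      (fun i hi => hA.inv_card_le hc (hmem (htk i hi)))
      (fun i hi => hA.sq_sum_le' (hmem (htk i hi)) subset_rfl f x)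
      (fun i hi => hA.sq_sum_le' (hmem (htk (i + 1) hi)) Finset.sdiff_subset f x)).trans ?_
    rw [hC, mul_one]
    gcongr ?_ * _
    calc 2 * (D : ℝ≥0∞) ^ 3 + 2 * (D : ℝ≥0∞) ^ 2 ≤ 4 * (D : ℝ≥0∞) ^ 3 + 4 * (D : ℝ≥0∞) ^ 2 := by
          gcongr <;> norm_num
      _ ≤ _ := le_self_add
  · refine hsq fun n t ht htk => ?_
    refine (sum_sq_norm_convAverage_sub_le (h := h) (D := D) (θ := 2 * (ι (k - i) : ℝ≥0∞) ^ 2)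
      (fun i hi => hA.location k _ (hmem (htk i hi)))
      (fun i hi => hA.card_ne_zero hc (hmem (htk i hi))) (hsub ht htk)
      (fun i hi => hA.inv_card_le hc (hmem (htk i hi)))
      (fun j hj => by
        simpa using hA.sq_sum_le hik (Or.inl rfl) (hmem (htk j hj)) hf hh x)
      (fun j hj => hA.sq_sum_le hik (Or.inr (hmem (htk j hj.le))) (hmem (htk (j + 1) hj))
        hf hh x)).trans ?_
    rw [← mul_assoc _ 2, mul_assoc _ (_ ^ 2), hC]
    gcongr ?_ * _
    calc (2 * (D : ℝ≥0∞) ^ 3 + 2 * (D : ℝ≥0∞) ^ 2) * 2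
        = 4 * (D : ℝ≥0∞) ^ 3 + 4 * (D : ℝ≥0∞) ^ 2 := by ring
      _ ≤ _ := le_self_add

end

/-! Layers at the boundaries of rectangles. -/

theorem prod_ite_mul (i : Fin d) (α : ℕ) (β : Fin d → ℕ) :
    (∏ j, if j = i then α else β j) * β i = α * ∏ j, β j := by
  rw [← Finset.mul_prod_erase Finset.univ _ (Finset.mem_univ i),
    ← Finset.mul_prod_erase Finset.univ β (Finset.mem_univ i), if_pos rfl,
    Finset.prod_congr rfl fun j hj => if_neg (Finset.ne_of_mem_erase hj)]
  ring

/-- The points of `H e'` within `2 ^ e i` of the upper face in direction `i` form the fraction `2 ^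
e i / (2 * 2 ^ e' i)` of the box, and a vector of `H e` carries each of them onto that face. -/
theorem two_pow_mul_card_le_boundaryCount {e e' : Fin d → ℕ} (h : e ≤ e') (i : Fin d) :
    2 ^ e i * (H e').card ≤ boundaryCount (H e') (H e) * (2 * 2 ^ e' i) := by
  classical
  set P : Finset (Fin d → ℤ) := Fintype.piFinset fun j =>
    if j = i then Finset.Ico (2 ^ e' i - 2 ^ e i) (2 ^ e' i) else Finset.Ico (-2 ^ e' j) (2 ^ e' j)
    with hP
  have hcard : P.card * (2 * 2 ^ e' i) = 2 ^ e i * (H e').card := by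
    have h1 : P.card = ∏ j, if j = i then 2 ^ e i else 2 * 2 ^ e' j := by
      rw [hP, Fintype.card_piFinset]
      refine Finset.prod_congr rfl fun j _ => ?_
      split_ifs
      · rw [Int.card_Ico]
        have : (2 : ℤ) ^ e' i - (2 ^ e' i - 2 ^ e i) = ((2 ^ e i : ℕ) : ℤ) := by push_cast; ring
        rw [this, Int.toNat_natCast]
      · rw [Int.card_Ico]
        have : (2 : ℤ) ^ e' j - -2 ^ e' j = ((2 * 2 ^ e' j : ℕ) : ℤ) := by push_cast; ring
        rw [this, Int.toNat_natCast]
    rw [h1, prod_ite_mul i (2 ^ e i) fun j => 2 * 2 ^ e' j, card_symBox, vol,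
      Finset.prod_mul_distrib]
    simp
  rw [← hcard]
  refine Nat.mul_le_mul_right _ ?_
  rw [boundaryCount, ← Set.ncard_coe_finset]
  refine Set.ncard_le_ncard_of_injOn (fun y => -y) (fun y hy => ?_)
    (fun _ _ _ _ h => neg_injective h) (finite_boundaryCount _ _)
  have hy' : ∀ j, y j ∈ _ := Fintype.mem_piFinset.1 hy
  have hi := hy' i
  rw [if_pos rfl, Finset.mem_Ico] at hi
  have hj : ∀ j, j ≠ i → -2 ^ e' j ≤ y j ∧ y j < 2 ^ e' j := by
    intro j hji
    have := hy' j
    rwa [if_neg hji, Finset.mem_Ico] at this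
  have hpos : ∀ j, (0 : ℤ) < 2 ^ e' j := fun j => by positivity
  have hpos' : ∀ j, (0 : ℤ) < 2 ^ e j := fun j => by positivity
  have hle : (2 : ℤ) ^ e i ≤ 2 ^ e' i := pow_le_pow_right₀ (by norm_num) (h i)
  -- The translation in direction `i` that moves `y` to the last layer of the box; one further unit
  -- step leaves it.
  refine ⟨Pi.single i (2 ^ e' i - 1 - y i), ?_, ?_, i, Or.inl ?_⟩
  · simp only [symBox, Fintype.mem_piFinset, Finset.mem_Ico, Nat.cast_one, one_mul]
    intro j
    rcases eq_or_ne j i with rfl | hji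
    · have := hpos' j
      rw [Pi.single_eq_same]
      omega
    · have := hpos' j
      rw [Pi.single_eq_of_ne hji]
      omega
  · simp only [symBox, Fintype.mem_piFinset, Finset.mem_Ico, Nat.cast_one, one_mul, sub_neg_eq_add,
      Pi.add_apply]
    intro j
    rcases eq_or_ne j i with rfl | hji
    · have := hpos j
      rw [Pi.single_eq_same]
      omega
    · rw [Pi.single_eq_of_ne hji, zero_add]
      exact hj j hji
  · simp only [symBox, Fintype.mem_piFinset, Finset.mem_Ico, Nat.cast_one, one_mul, sub_neg_eq_add,
      Pi.add_apply]
    intro hcon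
    have := hcon i
    rw [Pi.single_eq_same, Pi.single_eq_same] at this
    omega

/-- Eccentricity becomes a comparison of side lengths in each direction, the only form in which it
is used. -/
theorem JRWCriteria.two_pow_le {c : ℝ} {ι ε : ℕ → ℝ≥0} {a : ℕ → Fin d → ℕ}
    {𝒜 : ℕ → Set (Finset (Fin d → ℤ))} (hA : JRWCriteria c ι ε a 𝒜) (ha : Monotone a)
    {k q : ℕ} (hkq : k ≤ q) (i : Fin d) :
    (2 : ℝ≥0) ^ a k i ≤ 2 * ε (q - k) ^ 2 * 2 ^ a q i := by
  obtain ⟨l, rfl⟩ := Nat.exists_eq_add_of_le hkq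
  rw [Nat.add_sub_cancel_left]
  have h1 := hA.eccentricity k l
  have h3 : (H (a (k + l))).card ≠ 0 := by exact_mod_cast card_H_ne_zero (a (k + l))
  rw [div_le_iff₀ (by positivity)] at h1
  have h2 : (boundaryCount (H (a (k + l))) (H (a k)) : ℝ≥0) ≤ ε l ^ 2 * (H (a (k + l))).card := by
    exact_mod_cast h1
  have h4 : (2 : ℝ≥0) ^ a k i * (H (a (k + l))).card ≤
      boundaryCount (H (a (k + l))) (H (a k)) * (2 * 2 ^ a (k + l) i) := by
    exact_mod_cast two_pow_mul_card_le_boundaryCount (ha hkq) i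
  have h5 : (0 : ℝ≥0) < (H (a (k + l))).card := by positivity
  refine le_of_mul_le_mul_right (h4.trans ?_) h5
  calc _ ≤ ε l ^ 2 * (H (a (k + l))).card * (2 * 2 ^ a (k + l) i) := by gcongr
    _ = _ := by ring

/-- A point whose box leaves the atom is near one of two faces in some direction; the two slabs have
total thickness at most `16 * 2 ^ e i`, and there are `d` directions. -/
theorem card_layer_le {e e' : Fin d → ℕ} {δ : ℝ≥0} (h : ∀ i, (2 : ℝ≥0) ^ e i ≤ δ * 2 ^ e' i)
    (m : Fin d → ℤ) :
    (((atom e' m).filter fun y => ¬ nb 8 e y ⊆ atom e' m).card : ℝ≥0) ≤ 16 * d * δ * vol e' := by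
  classical
  set P : Fin d → Finset (Fin d → ℤ) := fun i => Fintype.piFinset fun j =>
    if j = i then Finset.Ico (2 ^ e' i * m i) (2 ^ e' i * m i + 8 * 2 ^ e i) ∪
      Finset.Ico (2 ^ e' i * (m i + 1) - 8 * 2 ^ e i) (2 ^ e' i * (m i + 1))
    else Finset.Ico (2 ^ e' j * m j) (2 ^ e' j * (m j + 1)) with hP
  have hsub : ((atom e' m).filter fun y => ¬ nb 8 e y ⊆ atom e' m) ⊆ Finset.univ.biUnion P := by
    intro y hy
    rw [Finset.mem_filter, mem_atom', Finset.not_subset] at hy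
    obtain ⟨hy, z, hz, hzm⟩ := hy
    rw [mem_nb] at hz
    rw [mem_atom'] at hzm
    push Not at hzm
    obtain ⟨i, hi⟩ := hzm
    rw [Finset.mem_biUnion]
    refine ⟨i, Finset.mem_univ i, Fintype.mem_piFinset.2 fun j => ?_⟩
    split_ifs with hji
    · subst hji
      have h1 := hy j
      have h2 := abs_le.1 (hz j)
      push_cast at h2
      rw [Finset.mem_union, Finset.mem_Ico, Finset.mem_Ico]
      by_cases h3 : 2 ^ e' j * m j ≤ z j
      · have := hi h3
        right
        constructor <;> linarith [h1.1, h1.2, h2.1, h2.2]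
      · left
        constructor <;> linarith [h1.1, h1.2, h2.1, h2.2]
    · exact Finset.mem_Ico.2 (hy j)
  have hcard : ∀ i, ((P i).card : ℝ≥0) ≤ 16 * δ * vol e' := by
    intro i
    have h1 : (P i).card ≤ ∏ j, if j = i then 16 * 2 ^ e i else 2 ^ e' j := by
      rw [hP, Fintype.card_piFinset]
      refine Finset.prod_le_prod' fun j _ => ?_
      split_ifs
      · refine (Finset.card_union_le _ _).trans ?_
        rw [Int.card_Ico, Int.card_Ico]
        have h2 : ∀ n : ℤ, n + 8 * 2 ^ e i - n = ((8 * 2 ^ e i : ℕ) : ℤ) := fun n => by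
          push_cast; ring
        have h3 : ∀ n : ℤ, n - (n - 8 * 2 ^ e i) = ((8 * 2 ^ e i : ℕ) : ℤ) := fun n => by
          push_cast; ring
        rw [h2, h3, Int.toNat_natCast]
        omega
      · rw [Int.card_Ico]
        have : (2 : ℤ) ^ e' j * (m j + 1) - 2 ^ e' j * m j = ((2 ^ e' j : ℕ) : ℤ) := by
          push_cast; ring
        rw [this, Int.toNat_natCast]
    have h2 : (P i).card * 2 ^ e' i ≤ 16 * 2 ^ e i * vol e' := by
      refine (Nat.mul_le_mul_right _ h1).trans ?_
      rw [prod_ite_mul i (16 * 2 ^ e i) fun j => 2 ^ e' j, vol]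
    have h3 : ((P i).card : ℝ≥0) * 2 ^ e' i ≤ 16 * 2 ^ e i * vol e' := by exact_mod_cast h2
    refine le_of_mul_le_mul_right (h3.trans ?_) (by positivity : (0 : ℝ≥0) < 2 ^ e' i)
    calc _ ≤ 16 * (δ * 2 ^ e' i) * (vol e' : ℝ≥0) := by gcongr; exact h i
      _ = _ := by ring
  calc _ ≤ ((Finset.univ.biUnion P).card : ℝ≥0) := by exact_mod_cast Finset.card_le_card hsub
    _ ≤ ∑ i, ((P i).card : ℝ≥0) := by exact_mod_cast Finset.card_biUnion_le
    _ ≤ ∑ _i : Fin d, 16 * δ * vol e' := Finset.sum_le_sum fun i _ => hcard i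
    _ = _ := by
      rw [Finset.sum_const, Finset.card_univ, Fintype.card_fin, nsmul_eq_mul]
      ring

/-! Conditional expectations. -/

theorem dyadicExpectation_congr_atom {e : Fin d → ℕ} (f : (Fin d → ℤ) → ℂ) {x y : Fin d → ℤ}
    (h : atomIndex e x = atomIndex e y) : dyadicExpectation e f x = dyadicExpectation e f y := by
  rw [dyadicExpectation, dyadicExpectation, h]

theorem dyadicExpectation_zero (f : (Fin d → ℤ) → ℂ) : dyadicExpectation 0 f = f := by
  funext x
  simp [dyadicExpectation, atomIndex_zero, atom_zero]

theorem sum_atom_dyadicExpectation (e : Fin d → ℕ) (f : (Fin d → ℤ) → ℂ) (m : Fin d → ℤ) :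
    ∑ x ∈ atom e m, dyadicExpectation e f x = ∑ x ∈ atom e m, f x := by
  have h : ∀ x ∈ atom e m, dyadicExpectation e f x = (vol e : ℂ)⁻¹ * ∑ y ∈ atom e m, f y := by
    intro x hx
    rw [dyadicExpectation, mem_atom.1 hx, card_atom]
  have h0 : (vol e : ℂ) ≠ 0 := by exact_mod_cast (vol_pos e).ne'
  rw [Finset.sum_congr rfl h, Finset.sum_const, card_atom, nsmul_eq_mul, mul_inv_cancel_left₀ h0]

theorem sum_dyadicExpectation {e : Fin d → ℕ} {U : Finset (Fin d → ℤ)} (hU : IsUnionOfAtoms e U)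
    (f : (Fin d → ℤ) → ℂ) : ∑ x ∈ U, dyadicExpectation e f x = ∑ x ∈ U, f x := by
  rw [sum_eq_sum_atoms hU, sum_eq_sum_atoms hU]
  exact Finset.sum_congr rfl fun m _ => sum_atom_dyadicExpectation e f m

theorem meanZero_sub {e e' : Fin d → ℕ} (h : e ≤ e') (f : (Fin d → ℤ) → ℂ) :
    MeanZero e' (dyadicExpectation e f - dyadicExpectation e' f) := by
  intro m
  simp only [Pi.sub_apply, Finset.sum_sub_distrib]
  rw [sum_atom_dyadicExpectation, sum_dyadicExpectation (isUnionOfAtoms_atom h m), sub_self]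

theorem enorm_sq_eq (z : ℂ) : ‖z‖ₑ ^ 2 = ENNReal.ofReal (Complex.normSq z) := by
  rw [← ofReal_norm, ← ENNReal.ofReal_pow (norm_nonneg z), Complex.normSq_eq_norm_sq]

theorem sum_sq_sub_add (S : Finset (Fin d → ℤ)) (g : (Fin d → ℤ) → ℂ) (z : ℂ)
    (h : ∑ y ∈ S, (g y - z) = 0) :
    ∑ y ∈ S, ‖g y - z‖ₑ ^ 2 + ∑ _y ∈ S, ‖z‖ₑ ^ 2 = ∑ y ∈ S, ‖g y‖ₑ ^ 2 := by
  simp only [enorm_sq_eq]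
  rw [← ENNReal.ofReal_sum_of_nonneg fun _ _ => Complex.normSq_nonneg _,
    ← ENNReal.ofReal_sum_of_nonneg fun _ _ => Complex.normSq_nonneg _,
    ← ENNReal.ofReal_sum_of_nonneg fun _ _ => Complex.normSq_nonneg _,
    ← ENNReal.ofReal_add (Finset.sum_nonneg fun _ _ => Complex.normSq_nonneg _)
      (Finset.sum_nonneg fun _ _ => Complex.normSq_nonneg _), ← Finset.sum_add_distrib]
  congr 1
  have h1 : ∀ y, Complex.normSq (g y) = Complex.normSq (g y - z) + Complex.normSq z +
      2 * ((g y - z) * (starRingEnd ℂ) z).re := by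
    intro y
    rw [← Complex.normSq_add, sub_add_cancel]
  rw [Finset.sum_congr rfl fun y _ => h1 y, Finset.sum_add_distrib (g := fun y => 2 * _),
    ← Finset.mul_sum, ← Complex.re_sum, ← Finset.sum_mul, h]
  simp

/-- On each coarse atom the coarse expectation is constant and the difference has sum zero, so the
cross terms vanish. -/
theorem pythagoras {e e' : Fin d → ℕ} (h : e ≤ e') (f : (Fin d → ℤ) → ℂ) :
    ∑' x, ‖(dyadicExpectation e f - dyadicExpectation e' f) x‖ₑ ^ 2 +
      ∑' x, ‖dyadicExpectation e' f x‖ₑ ^ 2 = ∑' x, ‖dyadicExpectation e f x‖ₑ ^ 2 := by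
  rw [tsum_eq_tsum_atom e', tsum_eq_tsum_atom e' fun x => ‖dyadicExpectation e' f x‖ₑ ^ 2,
    tsum_eq_tsum_atom e' fun x => ‖dyadicExpectation e f x‖ₑ ^ 2, ← ENNReal.tsum_add]
  refine tsum_congr fun m => ?_
  obtain ⟨z, hz⟩ : ∃ z, ∀ x ∈ atom e' m, dyadicExpectation e' f x = z :=
    ⟨(vol e' : ℂ)⁻¹ * ∑ y ∈ atom e' m, f y, fun x hx => by
      rw [dyadicExpectation, mem_atom.1 hx, card_atom]⟩
  have h0 := meanZero_sub h f m
  simp only [Pi.sub_apply] at h0 ⊢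
  have h1 : ∀ {M : Type} [AddCommMonoid M] (F : ℂ → ℂ → M), ∑ x ∈ atom e' m,
      F (dyadicExpectation e f x) (dyadicExpectation e' f x) =
      ∑ x ∈ atom e' m, F (dyadicExpectation e f x) z := fun F =>
    Finset.sum_congr rfl fun x hx => by rw [hz x hx]
  rw [h1 fun u w => u - w] at h0
  rw [h1 fun u w => ‖u - w‖ₑ ^ 2, h1 fun _ w => ‖w‖ₑ ^ 2]
  exact sum_sq_sub_add _ _ z h0

/-- The martingale difference `𝔼_i f - 𝔼_{i + 1} f`. -/
def martDiff (a : ℕ → Fin d → ℕ) (f : (Fin d → ℤ) → ℂ) (i : ℕ) : (Fin d → ℤ) → ℂ :=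
  dyadicExpectation (a i) f - dyadicExpectation (a (i + 1)) f

theorem tsum_sq_martDiff_le {a : ℕ → Fin d → ℕ} (ha0 : a 0 = 0) (ha : Monotone a)
    (f : (Fin d → ℤ) → ℂ) : ∑' i, ∑' x, ‖martDiff a f i x‖ₑ ^ 2 ≤ ∑' x, ‖f x‖ₑ ^ 2 := by
  refine ENNReal.tsum_le_of_sum_range_le fun n => ?_
  have h : ∑ i ∈ Finset.range n, ∑' x, ‖martDiff a f i x‖ₑ ^ 2 +
      ∑' x, ‖dyadicExpectation (a n) f x‖ₑ ^ 2 = ∑' x, ‖f x‖ₑ ^ 2 := by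
    induction n with
    | zero => simp [ha0, dyadicExpectation_zero]
    | succ n ih =>
      rw [Finset.sum_range_succ, add_assoc, martDiff, pythagoras (ha n.le_succ) f, ih]
  exact le_self_add.trans h.le

theorem sum_martDiff_add {a : ℕ → Fin d → ℕ} (ha0 : a 0 = 0) (f : (Fin d → ℤ) → ℂ) (n : ℕ) :
    ∑ i ∈ Finset.range n, martDiff a f i + dyadicExpectation (a n) f = f := by
  simp only [martDiff]
  rw [Finset.sum_range_sub', ha0, dyadicExpectation_zero, sub_add_cancel]

theorem IsDyadicSequence.le_sum {a : ℕ → Fin d → ℕ} (ha : IsDyadicSequence a) (n : ℕ) :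
    n ≤ ∑ i, a n i := by
  induction n with
  | zero => exact Nat.zero_le _
  | succ n ih =>
    obtain ⟨i, hi⟩ := ha.strict n
    have : ∑ i, a n i < ∑ i, a (n + 1) i :=
      Finset.sum_lt_sum (fun j _ => ha.mono n.le_succ j) ⟨i, Finset.mem_univ i, hi⟩
    omega

theorem IsDyadicSequence.tendsto_inv_vol {a : ℕ → Fin d → ℕ} (ha : IsDyadicSequence a) :
    Filter.Tendsto (fun n => (vol (a n) : ℝ≥0∞)⁻¹) Filter.atTop (nhds 0) := by
  refine tendsto_of_tendsto_of_tendsto_of_le_of_le tendsto_const_nhds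
    ENNReal.tendsto_inv_nat_nhds_zero (fun _ => zero_le) fun n => ?_
  refine ENNReal.inv_le_inv.2 ?_
  rw [vol_eq]
  exact_mod_cast (ha.le_sum n).trans (Nat.lt_two_pow_self).le

theorem tsum_indicator_comp_le (S : Set ℕ) (σ : ℕ → ℕ) (hσ : Set.InjOn σ S) (φ : ℕ → ℝ≥0∞) :
    ∑' i, S.indicator (fun i => φ (σ i)) i ≤ ∑' i, φ i := by
  rw [← tsum_subtype]
  exact ENNReal.tsum_comp_le_tsum_of_injective (f := fun i : S => σ i)
    (fun i j h => Subtype.ext (hσ i.2 j.2 h)) φ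

/-! ### Almost orthogonality of scales and the unweighted ℓ² estimate. -/

/-- The decay between the scales `k` and `i`. -/
def decay (ι ε : ℕ → ℝ≥0) (k i : ℕ) : ℝ≥0∞ := if i < k then ι (k - (i + 1)) else ε (i - k)

theorem decay_eq (ι ε : ℕ → ℝ≥0) (k i : ℕ) :
    decay ι ε k i = {i | i < k}.indicator (fun i => (ι (k - (i + 1)) : ℝ≥0∞)) i +
      {i | k ≤ i}.indicator (fun i => (ε (i - k) : ℝ≥0∞)) i := by
  rw [decay]
  split_ifs with h
  · simp [h]
  · simp [h, not_lt.1 h]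

theorem tsum_decay_le (ι ε : ℕ → ℝ≥0) (k : ℕ) :
    ∑' i, decay ι ε k i ≤ ∑' l, (ι l : ℝ≥0∞) + ∑' l, (ε l : ℝ≥0∞) := by
  simp only [decay_eq]
  rw [ENNReal.tsum_add]
  refine add_le_add ?_ ?_
  · refine tsum_indicator_comp_le {i | i < k} (fun i => k - (i + 1)) ?_ fun l => (ι l : ℝ≥0∞)
    intro i hi j hj h
    simp only [Set.mem_ofPred_eq] at hi hj h
    omega
  · refine tsum_indicator_comp_le {i | k ≤ i} (fun i => i - k) ?_ fun l => (ε l : ℝ≥0∞)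
    intro i hi j hj h
    simp only [Set.mem_ofPred_eq] at hi hj h
    omega

theorem tsum_decay_le' (ι ε : ℕ → ℝ≥0) (i : ℕ) :
    ∑' k, decay ι ε k i ≤ ∑' l, (ι l : ℝ≥0∞) + ∑' l, (ε l : ℝ≥0∞) := by
  have h : ∀ k, decay ι ε k i = {k | i < k}.indicator (fun k => (ι (k - (i + 1)) : ℝ≥0∞)) k +
      {k | k ≤ i}.indicator (fun k => (ε (i - k) : ℝ≥0∞)) k := fun k => decay_eq ι ε k i
  simp only [h]
  rw [ENNReal.tsum_add]
  refine add_le_add ?_ ?_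
  · refine tsum_indicator_comp_le {k | i < k} (fun k => k - (i + 1)) ?_ fun l => (ι l : ℝ≥0∞)
    intro i hi j hj h
    simp only [Set.mem_ofPred_eq] at hi hj h
    omega
  · refine tsum_indicator_comp_le {k | k ≤ i} (fun k => i - k) ?_ fun l => (ε l : ℝ≥0∞)
    intro i hi j hj h
    simp only [Set.mem_ofPred_eq] at hi hj h
    omega

theorem tsum_sum_nb_le (r : ℕ) (e : Fin d → ℕ) (φ : (Fin d → ℤ) → ℝ≥0∞) :
    ∑' x, (vol e : ℝ≥0∞)⁻¹ * ∑ y ∈ nb r e x, φ y ≤ (2 * r + 1) ^ d * ∑' x, φ x := by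
  rw [tsum_mul_sum_comm (nb r e) (fun _ _ => mem_nb_comm) φ fun _ => (vol e : ℝ≥0∞)⁻¹,
    ← ENNReal.tsum_mul_left]
  refine ENNReal.tsum_le_tsum fun y => ?_
  rw [Finset.sum_const, nsmul_eq_mul, mul_comm]
  gcongr
  calc ((nb r e y).card : ℝ≥0∞) * (vol e : ℝ≥0∞)⁻¹
      ≤ ((2 * r + 1) ^ d * vol e) * (vol e : ℝ≥0∞)⁻¹ := by
        gcongr
        exact_mod_cast card_nb_le r e y
    _ = _ := by rw [mul_assoc, vol_mul_inv, mul_one]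

namespace ScaleOperators

variable {a : ℕ → Fin d → ℕ} {ι ε : ℕ → ℝ≥0} {C : ℝ≥0} {r : ℕ}
  {T : ℕ → ((Fin d → ℤ) → ℂ) → (Fin d → ℤ) → ℝ≥0∞}

theorem zero (hT : ScaleOperators a ι C r T) (k : ℕ) (x : Fin d → ℤ) : T k 0 x = 0 :=
  hT.const k 0 0 x fun _ _ => rfl

theorem sum_le (hT : ScaleOperators a ι C r T) (k : ℕ) (f : ℕ → (Fin d → ℤ) → ℂ)
    (x : Fin d → ℤ) (I : Finset ℕ) : T k (∑ i ∈ I, f i) x ≤ ∑ i ∈ I, T k (f i) x :=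
  Finset.le_sum_of_subadditive (fun g => T k g x) (hT.zero k x).le (fun f g => hT.add_le k f g x) I f

theorem tsum_sq_le_of_meanZero (hT : ScaleOperators a ι C r T) {i k : ℕ} (hik : i ≤ k)
    {g : (Fin d → ℤ) → ℂ} (hg : MeanZero (a i) g) :
    ∑' x, T k g x ^ 2 ≤
      C * (2 * r + 1) ^ d * (ι (k - i) : ℝ≥0∞) ^ 2 * ∑' x, ‖g x‖ₑ ^ 2 := by
  refine (ENNReal.tsum_le_tsum fun x =>
    hT.cancel i k g (fun y => ‖g y‖ₑ ^ 2) x hik hg IsMajorant.sq).trans ?_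
  rw [ENNReal.tsum_mul_left, ENNReal.tsum_mul_left]
  calc _ ≤ C * ((ι (k - i) : ℝ≥0∞) ^ 2 * ((2 * r + 1) ^ d * ∑' x, ‖g x‖ₑ ^ 2)) := by
        gcongr
        exact tsum_sum_nb_le r (a k) _
    _ = _ := by ring

/-- By locality and vanishing on constants, `T k g x` can be nonzero only if the box around `x`
leaves its coarse atom. Every `y` in that box then has a box of radius 8 = 4 + 4 leaving its own
atom, so only the mass of `g` in thin boundary layers counts. -/
theorem tsum_sq_le_of_const (hT : ScaleOperators a ι C 4 T) {k q : ℕ} {δ : ℝ≥0}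
    (hδ : ∀ i, (2 : ℝ≥0) ^ a k i ≤ δ * 2 ^ a q i) {g : (Fin d → ℤ) → ℂ}
    (hg : ∀ x y, atomIndex (a q) x = atomIndex (a q) y → g x = g y) :
    ∑' x, T k g x ^ 2 ≤ C * 9 ^ d * (16 * d * δ) * ∑' x, ‖g x‖ₑ ^ 2 := by
  classical
  set φ : (Fin d → ℤ) → ℝ≥0∞ := fun y =>
    if nb 8 (a k) y ⊆ atom (a q) (atomIndex (a q) y) then 0 else ‖g y‖ₑ ^ 2 with hφ
  have h1 : ∀ x, T k g x ^ 2 ≤ C * ((vol (a k) : ℝ≥0∞)⁻¹ * ∑ y ∈ nb 4 (a k) x, φ y) := by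
    intro x
    by_cases hx : nb 4 (a k) x ⊆ atom (a q) (atomIndex (a q) x)
    · rw [hT.const k g (g x) x fun y hy => hg y x (mem_atom.1 (hx hy))]
      simp
    · refine (hT.sq_le k g x).trans (le_of_eq ?_)
      congr 2
      refine Finset.sum_congr rfl fun y hy => (if_neg fun hcon => hx ?_).symm
      have hsub : nb 4 (a k) x ⊆ nb 8 (a k) y := by
        intro z hz
        rw [mem_nb] at hy hz ⊢
        intro i
        have := abs_le.1 (hy i)
        have := abs_le.1 (hz i)
        push_cast at *
        rw [abs_le]
        constructor <;> linarith
      have hxy : atomIndex (a q) x = atomIndex (a q) y :=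
        mem_atom.1 (hcon (hsub (self_mem_nb 4 (a k) x)))
      rw [hxy]
      exact hsub.trans hcon
  have h2 : ∑' y, φ y ≤ (16 * d * δ : ℝ≥0) * ∑' x, ‖g x‖ₑ ^ 2 := by
    rw [tsum_eq_tsum_atom (a q) φ, tsum_eq_tsum_atom (a q) fun x => ‖g x‖ₑ ^ 2,
      ← ENNReal.tsum_mul_left]
    refine ENNReal.tsum_le_tsum fun m => ?_
    obtain ⟨z, hz⟩ : ∃ z, ∀ x ∈ atom (a q) m, g x = z := by
      by_cases hne : (atom (a q) m).Nonempty
      · obtain ⟨x, hx⟩ := hne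
        exact ⟨g x, fun y hy => hg y x ((mem_atom.1 hy).trans (mem_atom.1 hx).symm)⟩
      · exact ⟨0, fun x hx => absurd ⟨x, hx⟩ hne⟩
    have h3 : ∑ y ∈ atom (a q) m, φ y =
        ((atom (a q) m).filter fun y => ¬ nb 8 (a k) y ⊆ atom (a q) m).card * ‖z‖ₑ ^ 2 := by
      rw [← nsmul_eq_mul, ← Finset.sum_const, Finset.sum_filter]
      refine Finset.sum_congr rfl fun y hy => ?_
      rw [hφ]
      simp only [mem_atom.1 hy, hz y hy, ite_not]
    rw [h3, Finset.sum_congr rfl fun x hx => by rw [hz x hx], Finset.sum_const, card_atom,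
      nsmul_eq_mul, ← mul_assoc]
    gcongr
    exact_mod_cast card_layer_le hδ m
  calc _ ≤ ∑' x, C * ((vol (a k) : ℝ≥0∞)⁻¹ * ∑ y ∈ nb 4 (a k) x, φ y) :=
        ENNReal.tsum_le_tsum h1
    _ ≤ C * ((2 * (4 : ℕ) + 1) ^ d * ((16 * d * δ : ℝ≥0) * ∑' x, ‖g x‖ₑ ^ 2)) := by
        rw [ENNReal.tsum_mul_left]
        gcongr
        exact (tsum_sum_nb_le 4 (a k) φ).trans (by gcongr)
    _ = _ := by
        push_cast
        norm_num
        ring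

/-- The remainder after `n` differences is the expectation at scale `n`, whose square is at most
‖f‖₂² divided by the atom size; the local ℓ² bound sends its contribution to zero. -/
theorem le_tsum_martDiff (hT : ScaleOperators a ι C r T) (ha : IsDyadicSequence a)
    {f : (Fin d → ℤ) → ℂ} (hf : ∑' x, ‖f x‖ₑ ^ 2 ≠ ⊤) (k : ℕ) (x : Fin d → ℤ) :
    T k f x ≤ ∑' i, T k (martDiff a f i) x := by
  set F := ∑' x, ‖f x‖ₑ ^ 2 with hF
  set M : ℝ≥0∞ := C * ((vol (a k) : ℝ≥0∞)⁻¹ * ((nb r (a k) x).card * F)) with hM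
  have hMt : M ≠ ⊤ := by
    have := ENNReal.inv_ne_top.2 (vol_ne_zero (a k))
    finiteness
  have h1 : ∀ n, T k (dyadicExpectation (a n) f) x ≤ (M * (vol (a n) : ℝ≥0∞)⁻¹) ^ (1 / 2 : ℝ) := by
    intro n
    rw [le_rpow_half_iff]
    refine (hT.sq_le k _ x).trans ?_
    calc _ ≤ (C : ℝ≥0∞) * ((vol (a k) : ℝ≥0∞)⁻¹ *
          ∑ y ∈ nb r (a k) x, (vol (a n) : ℝ≥0∞)⁻¹ * F) := by
          gcongr with y hy
          refine (sq_norm_dyadicExpectation_le (a n) f y).trans ?_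
          gcongr
          exact ENNReal.sum_le_tsum _
      _ = _ := by
          rw [Finset.sum_const, nsmul_eq_mul, hM]
          ring
  have h2 : Filter.Tendsto (fun n => (∑' i, T k (martDiff a f i) x) +
      (M * (vol (a n) : ℝ≥0∞)⁻¹) ^ (1 / 2 : ℝ)) Filter.atTop
      (nhds ((∑' i, T k (martDiff a f i) x) + 0)) := by
    refine tendsto_const_nhds.add ?_
    have h3 := ENNReal.Tendsto.const_mul ha.tendsto_inv_vol (Or.inr hMt)
    rw [mul_zero] at h3
    have h4 := (ENNReal.continuous_rpow_const (y := 1 / 2)).tendsto 0 |>.comp h3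
    rwa [ENNReal.zero_rpow_of_pos (by norm_num)] at h4
  rw [add_zero] at h2
  refine ge_of_tendsto' h2 fun n => ?_
  calc T k f x = T k (∑ i ∈ Finset.range n, martDiff a f i + dyadicExpectation (a n) f) x := by
        rw [sum_martDiff_add ha.zero]
    _ ≤ T k (∑ i ∈ Finset.range n, martDiff a f i) x + T k (dyadicExpectation (a n) f) x :=
        hT.add_le k _ _ x
    _ ≤ _ := add_le_add ((hT.sum_le k _ x _).trans (ENNReal.sum_le_tsum _)) (h1 n)

theorem tsum_sq_martDiff_le (hT : ScaleOperators a ι C 4 T) (ha : Monotone a)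
    (hecc : ∀ k q, k ≤ q → ∀ i, (2 : ℝ≥0) ^ a k i ≤ 2 * ε (q - k) ^ 2 * 2 ^ a q i)
    (f : (Fin d → ℤ) → ℂ) (k i : ℕ) :
    ∑' x, T k (martDiff a f i) x ^ 2 ≤
      C * 9 ^ d * (32 * d + 1) * decay ι ε k i ^ 2 * ∑' x, ‖martDiff a f i x‖ₑ ^ 2 := by
  rw [decay]
  split_ifs with h
  -- The i-th difference has mean zero on the atoms of σ_{i+1}, not of σ_i; hence the shift by one
  -- in `decay`.
  · refine (hT.tsum_sq_le_of_meanZero (Nat.succ_le_of_lt h)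
      (meanZero_sub (ha i.le_succ) f)).trans (mul_le_mul' (mul_le_mul' ?_ le_rfl) le_rfl)
    calc (C : ℝ≥0∞) * (2 * (4 : ℕ) + 1) ^ d = C * 9 ^ d * 1 := by norm_num
      _ ≤ _ := mul_le_mul' le_rfl le_add_self
  · push Not at h
    refine (hT.tsum_sq_le_of_const (hecc k i h) (g := martDiff a f i) fun x y hxy => ?_).trans
      (mul_le_mul' ?_ le_rfl)
    · rw [martDiff, Pi.sub_apply, Pi.sub_apply, dyadicExpectation_congr_atom f hxy,
        dyadicExpectation_congr_atom f (atomIndex_mono (ha i.le_succ) hxy)]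
    · push_cast
      calc (C : ℝ≥0∞) * 9 ^ d * (16 * d * (2 * (ε (i - k) : ℝ≥0∞) ^ 2))
          = C * 9 ^ d * (32 * d) * (ε (i - k) : ℝ≥0∞) ^ 2 := by ring
        _ ≤ _ := mul_le_mul' (mul_le_mul' le_rfl le_self_add) le_rfl

/-- The unweighted `ℓ²` estimate. -/
theorem tsum_sq_le (hT : ScaleOperators a ι C 4 T) (ha : IsDyadicSequence a)
    (hι : ∀ l, ι l ≠ 0) (hε : ∀ l, ε l ≠ 0)
    (hecc : ∀ k q, k ≤ q → ∀ i, (2 : ℝ≥0) ^ a k i ≤ 2 * ε (q - k) ^ 2 * 2 ^ a q i)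
    {f : (Fin d → ℤ) → ℂ} (hf : ∑' x, ‖f x‖ₑ ^ 2 ≠ ⊤) :
    ∑' k, ∑' x, T k f x ^ 2 ≤ C * 9 ^ d * (32 * d + 1) *
      (∑' l, (ι l : ℝ≥0∞) + ∑' l, (ε l : ℝ≥0∞)) ^ 2 * ∑' x, ‖f x‖ₑ ^ 2 := by
  set s := ∑' l, (ι l : ℝ≥0∞) + ∑' l, (ε l : ℝ≥0∞) with hs
  set B : ℝ≥0∞ := C * 9 ^ d * (32 * d + 1) with hB
  have hu0 : ∀ k i, decay ι ε k i ≠ 0 := by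
    intro k i
    rw [decay]
    split_ifs
    · exact_mod_cast hι _
    · exact_mod_cast hε _
  have hut : ∀ k i, decay ι ε k i ≠ ⊤ := by
    intro k i
    rw [decay]
    split_ifs <;> exact ENNReal.coe_ne_top
  -- Schur test: Cauchy–Schwarz with weights `decay` consumes one of the two decay factors here; the
  -- other is summed over `k` afterwards.
  have h1 : ∀ k, ∑' x, T k f x ^ 2 ≤
      s * ∑' i, B * (decay ι ε k i * ∑' x, ‖martDiff a f i x‖ₑ ^ 2) := by
    intro k
    calc ∑' x, T k f x ^ 2
        ≤ ∑' x, s * ∑' i, (decay ι ε k i)⁻¹ * T k (martDiff a f i) x ^ 2 := by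
          refine ENNReal.tsum_le_tsum fun x => ?_
          refine (pow_le_pow_left' (hT.le_tsum_martDiff ha hf k x) 2).trans ?_
          refine (sq_tsum_le_weighted _ _ (hu0 k) (hut k)).trans ?_
          gcongr
          exact tsum_decay_le ι ε k
      _ = s * ∑' i, (decay ι ε k i)⁻¹ * ∑' x, T k (martDiff a f i) x ^ 2 := by
          rw [ENNReal.tsum_mul_left, ENNReal.tsum_comm]
          simp only [ENNReal.tsum_mul_left]
      _ ≤ _ := by
          refine mul_le_mul' le_rfl (ENNReal.tsum_le_tsum fun i => ?_)
          calc _ ≤ (decay ι ε k i)⁻¹ *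
                (B * decay ι ε k i ^ 2 * ∑' x, ‖martDiff a f i x‖ₑ ^ 2) :=
                mul_le_mul' le_rfl (hT.tsum_sq_martDiff_le ha.mono hecc f k i)
            _ = (decay ι ε k i * (decay ι ε k i)⁻¹) *
                (B * (decay ι ε k i * ∑' x, ‖martDiff a f i x‖ₑ ^ 2)) := by ring
            _ = _ := by rw [ENNReal.mul_inv_cancel (hu0 k i) (hut k i), one_mul]
  calc _ ≤ ∑' k, s * ∑' i, B * (decay ι ε k i * ∑' x, ‖martDiff a f i x‖ₑ ^ 2) :=
        ENNReal.tsum_le_tsum h1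
    _ = s * (B * ∑' i, (∑' k, decay ι ε k i) * ∑' x, ‖martDiff a f i x‖ₑ ^ 2) := by
        simp only [ENNReal.tsum_mul_left]
        rw [ENNReal.tsum_comm]
        simp only [ENNReal.tsum_mul_right]
    _ ≤ s * (B * ∑' i, s * ∑' x, ‖martDiff a f i x‖ₑ ^ 2) := by
        gcongr with i
        exact tsum_decay_le' ι ε i
    _ ≤ s * (B * (s * ∑' x, ‖f x‖ₑ ^ 2)) := by
        rw [ENNReal.tsum_mul_left]
        gcongr
        exact ShiftedSquare.tsum_sq_martDiff_le ha.zero ha.mono f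
    _ = _ := by ring

end ScaleOperators

/-! ### A_1 weights on rectangles. -/

/-- The weight `V` is essentially constant, up to averaging, on translates of the rectangles
`5 H` with exponents `b j`. -/
def IsRectWeight (B : ℝ≥0∞) (b : ℕ → Fin d → ℕ) (V : (Fin d → ℤ) → ℝ≥0∞) : Prop :=
  ∀ (j : ℕ) (S : Finset (Fin d → ℤ)) (y z : Fin d → ℤ), (∀ x ∈ S, x - y ∈ symBox 5 (b j)) →
    z - y ∈ symBox 5 (b j) → ∑ x ∈ S, V x ≤ B * vol (b j) * V z

/-- The average of `v` over a translate of 5H' is at most its rectangular maximal function at any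
point there, hence at most `K * A * v`. The factor `10 ^ d` is |5H'| relative to an atom; `v` is
cast to ℂ because cubicity concerns complex functions. -/
theorem IsA1Weight.isRectWeight {A K : ℝ≥0} {v : (Fin d → ℤ) → ℝ} (hv : IsA1Weight A v)
    {b : ℕ → Fin d → ℕ} (hb : ∀ f x, maximalRect b f x ≤ K * maximalHL f x) :
    IsRectWeight (K * A * 10 ^ d) b fun x => ENNReal.ofReal (v x) := by
  classical
  intro j S y z hS hz
  have hnorm : ∀ x, ‖((v x : ℝ) : ℂ)‖ₑ = ENNReal.ofReal (v x) := fun x => by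
    rw [← ofReal_norm, Complex.norm_real, Real.norm_of_nonneg (hv.pos x).le]
  have hnorm' : ∀ x, ‖v x‖ₑ = ENNReal.ofReal (v x) := fun x => by
    rw [← ofReal_norm, Real.norm_of_nonneg (hv.pos x).le]
  have h1 : maximalHL (fun x => ((v x : ℝ) : ℂ)) z = maximalHL v z := by
    simp only [maximalHL, absAverage, hnorm, hnorm']
  set P := (symBox 5 (b j)).image fun z => y + z with hP
  have h2 : absAverage P (fun x => ((v x : ℝ) : ℂ)) ≤ K * A * ENNReal.ofReal (v z) := by
    calc _ ≤ maximalRect b (fun x => ((v x : ℝ) : ℂ)) z :=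
          le_iSup_of_le j (le_iSup_of_le y (le_iSup_of_le hz le_rfl))
      _ ≤ K * maximalHL v z := h1 ▸ hb _ z
      _ ≤ K * (A * ENNReal.ofReal (v z)) := by
          gcongr
          exact hv.maximal_le z
      _ = _ := by ring
  have hcard : (P.card : ℝ≥0∞) = 10 ^ d * vol (b j) := by
    rw [hP, Finset.card_image_of_injective _ (add_right_injective y), card_symBox]
    push_cast
    norm_num
  have hP0 : (P.card : ℝ≥0∞) ≠ 0 := by
    rw [hcard]
    exact mul_ne_zero (by simp) (vol_ne_zero _)
  calc ∑ x ∈ S, ENNReal.ofReal (v x) ≤ ∑ x ∈ P, ENNReal.ofReal (v x) := by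
        refine Finset.sum_le_sum_of_subset fun x hx => ?_
        exact Finset.mem_image.2 ⟨x - y, hS x hx, by simp⟩
    _ = absAverage P (fun x => ((v x : ℝ) : ℂ)) * P.card := by
        simp only [absAverage, hnorm]
        rw [ENNReal.div_mul_cancel hP0 (ENNReal.natCast_ne_top _)]
    _ ≤ K * A * ENNReal.ofReal (v z) * P.card := by gcongr
    _ = _ := by
        rw [hcard]
        ring

theorem sub_mem_symBox_of_lt {r : ℕ} {e : Fin d → ℕ} {x y : Fin d → ℤ}
    (h : ∀ i, |x i - y i| < r * 2 ^ e i) : x - y ∈ symBox r e := by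
  simp only [symBox, Fintype.mem_piFinset, Finset.mem_Ico, Pi.sub_apply]
  exact fun i => ⟨(abs_lt.1 (h i)).1.le, (abs_lt.1 (h i)).2⟩

theorem sub_mem_symBox_of_mem_nb {e : Fin d → ℕ} {x y : Fin d → ℤ} (h : x ∈ nb 4 e y) :
    x - y ∈ symBox 5 e := by
  refine sub_mem_symBox_of_lt fun i => (mem_nb.1 h i).trans_lt ?_
  have : (0 : ℤ) < 2 ^ e i := by positivity
  push_cast
  linarith

theorem sub_mem_symBox_of_atomIndex_eq {e : Fin d → ℕ} {x y : Fin d → ℤ}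
    (h : atomIndex e x = atomIndex e y) : x - y ∈ symBox 5 e := by
  refine sub_mem_symBox_of_mem_nb (mem_nb.2 fun i => (abs_sub_lt_of_atomIndex_eq h i).le.trans ?_)
  have : (0 : ℤ) < 2 ^ e i := by positivity
  push_cast
  linarith

theorem IsRectWeight.sum_nb_le {B : ℝ≥0∞} {b : ℕ → Fin d → ℕ} {V : (Fin d → ℤ) → ℝ≥0∞}
    (hV : IsRectWeight B b V) (j : ℕ) (x : Fin d → ℤ) :
    (vol (b j) : ℝ≥0∞)⁻¹ * ∑ y ∈ nb 4 (b j) x, V y ≤ B * V x := by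
  have h := hV j (nb 4 (b j) x) x x (fun y hy => sub_mem_symBox_of_mem_nb hy)
    (sub_mem_symBox_of_mem_nb (self_mem_nb _ _ _))
  calc _ ≤ (vol (b j) : ℝ≥0∞)⁻¹ * (B * vol (b j) * V x) := by gcongr
    _ = (vol (b j) * (vol (b j) : ℝ≥0∞)⁻¹) * (B * V x) := by ring
    _ = _ := by rw [vol_mul_inv, one_mul]

/-- The atom and the neighbourhood of `x` lie in one translate of 5H'. As `z` is free in the
neighbourhood, the average over the atom is controlled by the local minimum of the weight. -/
theorem IsRectWeight.sum_atom_le {B : ℝ≥0∞} {b : ℕ → Fin d → ℕ} {V : (Fin d → ℤ) → ℝ≥0∞}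
    (hV : IsRectWeight B b V) (j : ℕ) {x z : Fin d → ℤ} (hz : z ∈ nb 4 (b j) x) :
    (vol (b j) : ℝ≥0∞)⁻¹ * ∑ y ∈ atom (b j) (atomIndex (b j) x), V y ≤ B * V z := by
  have h := hV j (atom (b j) (atomIndex (b j) x)) x z
    (fun y hy => sub_mem_symBox_of_atomIndex_eq (mem_atom.1 hy)) (sub_mem_symBox_of_mem_nb hz)
  calc _ ≤ (vol (b j) : ℝ≥0∞)⁻¹ * (B * vol (b j) * V z) := by gcongr
    _ = (vol (b j) * (vol (b j) : ℝ≥0∞)⁻¹) * (B * V z) := by ring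
    _ = _ := by rw [vol_mul_inv, one_mul]

theorem mem_atom_atomIndex_comm (e : Fin d → ℕ) (x y : Fin d → ℤ) :
    y ∈ atom e (atomIndex e x) ↔ x ∈ atom e (atomIndex e y) := by
  rw [mem_atom, mem_atom, eq_comm]

theorem nb_nonempty (r : ℕ) (e : Fin d → ℕ) (x : Fin d → ℤ) : (nb r e x).Nonempty :=
  ⟨x, self_mem_nb r e x⟩

/-- Functions constant on atoms only see local minima of the weight. -/
theorem IsRectWeight.tsum_mul_le {B : ℝ≥0∞} {b : ℕ → Fin d → ℕ} {V : (Fin d → ℤ) → ℝ≥0∞}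
    (hV : IsRectWeight B b V) (j : ℕ) {φ : (Fin d → ℤ) → ℝ≥0∞}
    (hφ : ∀ x y, atomIndex (b j) x = atomIndex (b j) y → φ x = φ y) :
    ∑' x, φ x * V x ≤
      B * ∑' x, φ x * (nb 4 (b j) x).inf' (nb_nonempty 4 (b j) x) V := by
  -- Writing `φ` as its own average over the atom lets the averaging be moved onto `V`.
  have h1 : ∀ x, φ x * V x =
      (vol (b j) : ℝ≥0∞)⁻¹ * V x * ∑ y ∈ atom (b j) (atomIndex (b j) x), φ y := by
    intro x
    rw [Finset.sum_congr rfl fun y hy => hφ y x (mem_atom.1 hy), Finset.sum_const, card_atom,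
      nsmul_eq_mul]
    calc φ x * V x = (vol (b j) * (vol (b j) : ℝ≥0∞)⁻¹) * (φ x * V x) := by
          rw [vol_mul_inv, one_mul]
      _ = _ := by ring
  simp only [h1]
  rw [tsum_mul_sum_comm (fun x => atom (b j) (atomIndex (b j) x))
    (mem_atom_atomIndex_comm (b j)) φ, ← ENNReal.tsum_mul_left]
  refine ENNReal.tsum_le_tsum fun x => ?_
  obtain ⟨z, hz, hzV⟩ := Finset.exists_mem_eq_inf' (nb_nonempty 4 (b j) x) V
  rw [hzV, ← Finset.mul_sum]
  calc _ ≤ φ x * (B * V z) := mul_le_mul' le_rfl (hV.sum_atom_le j hz)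
    _ = _ := by ring

/-! ### From unweighted to weighted ℓ² by the layer-cake formula. -/

open MeasureTheory in
theorem lintegral_lt_eq (w : ℝ≥0∞) :
    ∫⁻ s : ℝ in Set.Ioi 0, (if ENNReal.ofReal s < w then 1 else 0) = w := by
  have hm : MeasurableSet {s : ℝ | ENNReal.ofReal s < w} :=
    measurableSet_lt ENNReal.measurable_ofReal measurable_const
  have h : (fun s : ℝ => (if ENNReal.ofReal s < w then 1 else 0 : ℝ≥0∞)) =
      {s : ℝ | ENNReal.ofReal s < w}.indicator 1 := by
    funext s
    simp [Set.indicator_apply]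
  rw [h, lintegral_indicator_one hm, Measure.restrict_apply hm]
  by_cases hw : w = ⊤
  · have : {s : ℝ | ENNReal.ofReal s < w} ∩ Set.Ioi 0 = Set.Ioi 0 := by
      ext s
      simp [hw]
    rw [this, Real.volume_Ioi, hw]
  · have : {s : ℝ | ENNReal.ofReal s < w} ∩ Set.Ioi 0 = Set.Ioo 0 w.toReal := by
      ext s
      simp only [Set.mem_inter_iff, Set.mem_ofPred_eq, Set.mem_Ioi, Set.mem_Ioo]
      constructor
      · rintro ⟨h1, h2⟩
        exact ⟨h2, (ENNReal.ofReal_lt_iff_lt_toReal h2.le hw).1 h1⟩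
      · rintro ⟨h1, h2⟩
        exact ⟨(ENNReal.ofReal_lt_iff_lt_toReal h1.le hw).2 h2, h1⟩
    rw [this, Real.volume_Ioo, sub_zero, ENNReal.ofReal_toReal hw]

open MeasureTheory in
theorem lintegral_tsum_mul_lt {κ : Type*} [Countable κ] (φ w : κ → ℝ≥0∞) :
    ∫⁻ s : ℝ in Set.Ioi 0, ∑' x, φ x * (if ENNReal.ofReal s < w x then 1 else 0) =
      ∑' x, φ x * w x := by
  have hm : ∀ x, Measurable fun s : ℝ => (if ENNReal.ofReal s < w x then 1 else 0 : ℝ≥0∞) :=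
    fun x => Measurable.ite (measurableSet_lt ENNReal.measurable_ofReal measurable_const)
      measurable_const measurable_const
  rw [lintegral_tsum fun x => ((hm x).const_mul _).aemeasurable]
  refine tsum_congr fun x => ?_
  rw [lintegral_const_mul _ (hm x), lintegral_lt_eq]

open MeasureTheory in
/-- The weighted `ℓ²` estimate follows from the unweighted one by locality. -/
theorem ScaleOperators.tsum_sq_mul_le {a : ℕ → Fin d → ℕ} {ι : ℕ → ℝ≥0} {C : ℝ≥0}
    {T : ℕ → ((Fin d → ℤ) → ℂ) → (Fin d → ℤ) → ℝ≥0∞} (hT : ScaleOperators a ι C 4 T)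
    (hatom : ∀ k f x y, atomIndex (a k) x = atomIndex (a k) y → T k f x = T k f y)
    {B B₂ : ℝ≥0∞} (hB₂t : B₂ ≠ ⊤) (hB₂ : ∀ f : (Fin d → ℤ) → ℂ, ∑' x, ‖f x‖ₑ ^ 2 ≠ ⊤ →
      ∑' k, ∑' x, T k f x ^ 2 ≤ B₂ * ∑' x, ‖f x‖ₑ ^ 2)
    {V : (Fin d → ℤ) → ℝ≥0∞} (hV : IsRectWeight B a V) {f : (Fin d → ℤ) → ℂ}
    (hf : ∑' x, ‖f x‖ₑ ^ 2 ≠ ⊤) :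
    ∑' k, ∑' x, T k f x ^ 2 * V x ≤ B * B₂ * ∑' x, ‖f x‖ₑ ^ 2 * V x := by
  classical
  set w : ℕ → (Fin d → ℤ) → ℝ≥0∞ := fun k x =>
    (nb 4 (a k) x).inf' (nb_nonempty 4 (a k) x) V with hw
  have h1 : ∑' k, ∑' x, T k f x ^ 2 * V x ≤ B * ∑' k, ∑' x, T k f x ^ 2 * w k x := by
    rw [← ENNReal.tsum_mul_left]
    refine ENNReal.tsum_le_tsum fun k => hV.tsum_mul_le k fun x y hxy => ?_
    rw [hatom k f x y hxy]
  refine h1.trans ?_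
  rw [mul_assoc]
  gcongr
  rw [← ENNReal.tsum_prod (f := fun k x => T k f x ^ 2 * w k x),
    ← lintegral_tsum_mul_lt (fun p : ℕ × (Fin d → ℤ) => T p.1 f p.2 ^ 2) (fun p => w p.1 p.2),
    ← lintegral_tsum_mul_lt (fun x => ‖f x‖ₑ ^ 2) V,
    ← lintegral_const_mul' _ _ hB₂t]
  refine lintegral_mono fun s => ?_
  -- If the local minimum of `V` near `x` exceeds `s`, then `f` and this truncation agree on the
  -- whole box seen by `T k` at `x`. So the unweighted estimate for `g` bounds the integrand at
  -- level `s`.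
  set g : (Fin d → ℤ) → ℂ := fun y => if ENNReal.ofReal s < V y then f y else 0 with hg
  have hgf : ∀ x, ‖g x‖ₑ ^ 2 = ‖f x‖ₑ ^ 2 * (if ENNReal.ofReal s < V x then 1 else 0) := by
    intro x
    rw [hg]
    dsimp only
    split_ifs <;> simp
  have hgt : ∑' x, ‖g x‖ₑ ^ 2 ≠ ⊤ := by
    refine ne_top_of_le_ne_top hf (ENNReal.tsum_le_tsum fun x => ?_)
    rw [hgf]
    exact mul_le_of_le_one_right' (by split_ifs <;> simp)
  have h2 : ∀ k x, T k f x ^ 2 * (if ENNReal.ofReal s < w k x then 1 else 0) ≤ T k g x ^ 2 := by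
    intro k x
    split_ifs with hs
    · have hs := (Finset.lt_inf'_iff _).1 hs
      rw [mul_one, hT.congr k f g x fun y hy => (if_pos (hs y hy)).symm]
    · simp
  calc _ ≤ ∑' p : ℕ × (Fin d → ℤ), T p.1 g p.2 ^ 2 := ENNReal.tsum_le_tsum fun p => h2 p.1 p.2
    _ = ∑' k, ∑' x, T k g x ^ 2 := ENNReal.tsum_prod (f := fun k x => T k g x ^ 2)
    _ ≤ B₂ * ∑' x, ‖g x‖ₑ ^ 2 := hB₂ g hgt
    _ = _ := by simp only [hgf]

/-! ### Stopping cells and the Calderón–Zygmund decomposition. -/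

/-- The average of `|f|` over the atom with exponents `e` that contains `x`. -/
def normAverage (e : Fin d → ℕ) (f : (Fin d → ℤ) → ℂ) (x : Fin d → ℤ) : ℝ≥0∞ :=
  (vol e : ℝ≥0∞)⁻¹ * ∑ y ∈ atom e (atomIndex e x), ‖f y‖ₑ

theorem norm_dyadicExpectation_le (e : Fin d → ℕ) (f : (Fin d → ℤ) → ℂ) (x : Fin d → ℤ) :
    ‖dyadicExpectation e f x‖ₑ ≤ normAverage e f x := by
  rw [dyadicExpectation, card_atom, enorm_mul, enorm_inv_natCast (vol_pos e).ne', normAverage]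
  gcongr
  exact enorm_sum_le _ _

/-- Generations `τ x` such that the atoms of generation `τ x` around `x` form a partition. -/
def IsStopping (b : ℕ → Fin d → ℕ) (τ : (Fin d → ℤ) → ℕ) : Prop :=
  ∀ x y, atomIndex (b (τ x)) x = atomIndex (b (τ x)) y → τ y = τ x

/-- The atom of generation `τ x` around `x`. -/
def cell (b : ℕ → Fin d → ℕ) (τ : (Fin d → ℤ) → ℕ) (x : Fin d → ℤ) : Finset (Fin d → ℤ) :=
  atom (b (τ x)) (atomIndex (b (τ x)) x)

/-- The good part of `f`, its averages over the cells. -/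
def goodPart (b : ℕ → Fin d → ℕ) (τ : (Fin d → ℤ) → ℕ) (f : (Fin d → ℤ) → ℂ)
    (x : Fin d → ℤ) : ℂ := dyadicExpectation (b (τ x)) f x

section

variable {b : ℕ → Fin d → ℕ} {τ : (Fin d → ℤ) → ℕ}

theorem IsStopping.eq_of_mem (hτ : IsStopping b τ) {x y : Fin d → ℤ} (h : y ∈ cell b τ x) :
    τ y = τ x :=
  hτ x y (mem_atom.1 h).symm

theorem IsStopping.mem_cell_of_mem (hτ : IsStopping b τ) {x y : Fin d → ℤ}
    (h : y ∈ cell b τ x) : x ∈ cell b τ y := by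
  have h1 := hτ.eq_of_mem h
  rw [cell, h1]
  exact (mem_atom_atomIndex_comm _ x y).1 h

theorem IsStopping.mem_cell_comm (hτ : IsStopping b τ) (x y : Fin d → ℤ) :
    y ∈ cell b τ x ↔ x ∈ cell b τ y :=
  ⟨hτ.mem_cell_of_mem, hτ.mem_cell_of_mem⟩

theorem card_cell (x : Fin d → ℤ) : (cell b τ x).card = vol (b (τ x)) := card_atom _ _

theorem IsStopping.tsum_normAverage_mul (hτ : IsStopping b τ) (f : (Fin d → ℤ) → ℂ)
    (ψ : (Fin d → ℤ) → ℝ≥0∞) : ∑' x, normAverage (b (τ x)) f x * ψ x =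
      ∑' y, ‖f y‖ₑ * ((vol (b (τ y)) : ℝ≥0∞)⁻¹ * ∑ x ∈ cell b τ y, ψ x) := by
  have h := tsum_mul_sum_comm (cell b τ) hτ.mem_cell_comm (fun y => ‖f y‖ₑ)
    fun x => (vol (b (τ x)) : ℝ≥0∞)⁻¹ * ψ x
  calc _ = ∑' x, (vol (b (τ x)) : ℝ≥0∞)⁻¹ * ψ x * ∑ y ∈ cell b τ x, ‖f y‖ₑ :=
        tsum_congr fun x => by rw [normAverage, cell]; ring
    _ = _ := h
    _ = _ := by
        refine tsum_congr fun y => ?_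
        rw [Finset.mul_sum (cell b τ y) ψ]
        congr 1
        exact Finset.sum_congr rfl fun x hx => by rw [hτ.eq_of_mem hx]

theorem IsStopping.tsum_normAverage (hτ : IsStopping b τ) (f : (Fin d → ℤ) → ℂ) :
    ∑' x, normAverage (b (τ x)) f x = ∑' y, ‖f y‖ₑ := by
  have h := hτ.tsum_normAverage_mul f fun _ => 1
  simp only [mul_one, Finset.sum_const, nsmul_eq_mul, card_cell] at h
  rw [h]
  refine tsum_congr fun y => ?_
  rw [mul_comm (_⁻¹), vol_mul_inv, mul_one]

theorem IsStopping.tsum_normAverage_mul_le (hτ : IsStopping b τ) (f : (Fin d → ℤ) → ℂ)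
    {B : ℝ≥0∞} {V : (Fin d → ℤ) → ℝ≥0∞} (hV : IsRectWeight B b V) :
    ∑' x, normAverage (b (τ x)) f x * V x ≤ B * ∑' y, ‖f y‖ₑ * V y := by
  rw [hτ.tsum_normAverage_mul, ← ENNReal.tsum_mul_left]
  refine ENNReal.tsum_le_tsum fun y => ?_
  calc _ ≤ ‖f y‖ₑ * (B * V y) :=
        mul_le_mul' le_rfl (hV.sum_atom_le (τ y) (self_mem_nb 4 (b (τ y)) y))
    _ = _ := by ring

theorem IsStopping.sum_comm (hτ : IsStopping b τ) {M : Type*} [AddCommMonoid M]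
    {S : Finset (Fin d → ℤ)} (hS : ∀ x ∈ S, cell b τ x ⊆ S)
    (u : (Fin d → ℤ) → (Fin d → ℤ) → M) :
    ∑ x ∈ S, ∑ y ∈ cell b τ x, u x y = ∑ y ∈ S, ∑ x ∈ cell b τ y, u x y := by
  refine Finset.sum_comm' fun x y => ?_
  rw [hτ.mem_cell_comm x y]
  exact ⟨fun h => ⟨h.2, hS x h.1 (hτ.mem_cell_of_mem h.2)⟩,
    fun h => ⟨hS y h.2 h.1, h.1⟩⟩

theorem IsStopping.sum_goodPart (hτ : IsStopping b τ) {S : Finset (Fin d → ℤ)}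
    (hS : ∀ x ∈ S, cell b τ x ⊆ S) (f : (Fin d → ℤ) → ℂ) :
    ∑ x ∈ S, goodPart b τ f x = ∑ x ∈ S, f x := by
  have h := hτ.sum_comm hS fun x y => (vol (b (τ x)) : ℂ)⁻¹ * f y
  calc _ = ∑ x ∈ S, ∑ y ∈ cell b τ x, (vol (b (τ x)) : ℂ)⁻¹ * f y :=
        Finset.sum_congr rfl fun x _ => by
          rw [goodPart, dyadicExpectation, card_atom, Finset.mul_sum, cell]
    _ = _ := h
    _ = _ := by
        refine Finset.sum_congr rfl fun y _ => ?_
        have h0 : (vol (b (τ y)) : ℂ) ≠ 0 := by exact_mod_cast (vol_pos _).ne'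
        rw [Finset.sum_congr rfl fun x hx => by rw [hτ.eq_of_mem hx], Finset.sum_const, card_cell,
          nsmul_eq_mul, mul_inv_cancel_left₀ h0]

theorem IsStopping.sum_normAverage (hτ : IsStopping b τ) {S : Finset (Fin d → ℤ)}
    (hS : ∀ x ∈ S, cell b τ x ⊆ S) (f : (Fin d → ℤ) → ℂ) :
    ∑ x ∈ S, normAverage (b (τ x)) f x = ∑ x ∈ S, ‖f x‖ₑ := by
  have h := hτ.sum_comm hS fun x y => (vol (b (τ x)) : ℝ≥0∞)⁻¹ * ‖f y‖ₑ
  calc _ = ∑ x ∈ S, ∑ y ∈ cell b τ x, (vol (b (τ x)) : ℝ≥0∞)⁻¹ * ‖f y‖ₑ :=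
        Finset.sum_congr rfl fun x _ => by rw [normAverage, Finset.mul_sum, cell]
    _ = _ := h
    _ = _ := by
        refine Finset.sum_congr rfl fun y _ => ?_
        rw [Finset.sum_congr rfl fun x hx => by rw [hτ.eq_of_mem hx], Finset.sum_const, card_cell,
          nsmul_eq_mul, ← mul_assoc, vol_mul_inv, one_mul]

/-! The exceptional set. -/

/-- The union of the enlarged cells of positive generation. -/
def exceptionalSet (b : ℕ → Fin d → ℕ) (τ : (Fin d → ℤ) → ℕ) : Set (Fin d → ℤ) :=
  {x | ∃ y, 0 < τ y ∧ x ∈ nb 4 (b (τ y)) y}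

/-- The weight of an enlarged cell costs one factor `B`, and replacing averages of |f| over cells by
|f| itself costs the other. -/
theorem IsStopping.weight_exceptionalSet_le (hτ : IsStopping b τ) {f : (Fin d → ℤ) → ℂ}
    {L : ℝ≥0∞} (hL : ∀ y, 0 < τ y → L ≤ normAverage (b (τ y)) f y)
    {B : ℝ≥0∞} {V : (Fin d → ℤ) → ℝ≥0∞} (hV : IsRectWeight B b V) :
    L * ∑' x, (exceptionalSet b τ).indicator V x ≤ B ^ 2 * ∑' y, ‖f y‖ₑ * V y := by
  classical
  set N : (Fin d → ℤ) → Finset (Fin d → ℤ) := fun y =>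
    (symBox 5 (b (τ y))).image fun z => y + z with hN
  have hmemN : ∀ x y, x ∈ N y ↔ x - y ∈ symBox 5 (b (τ y)) := by
    intro x y
    rw [hN, Finset.mem_image]
    exact ⟨by rintro ⟨z, hz, rfl⟩; simpa using hz, fun h => ⟨_, h, by simp⟩⟩
  -- Summing over points with the inverse cell size counts each cell once, without choosing
  -- representatives.
  set u : (Fin d → ℤ) → (Fin d → ℤ) → ℝ≥0∞ := fun x y =>
    if 0 < τ y ∧ x ∈ N y then (vol (b (τ y)) : ℝ≥0∞)⁻¹ * L else 0 with hu
  have h1 : ∀ x, L * (exceptionalSet b τ).indicator V x ≤ ∑' y, u x y * V x := by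
    intro x
    by_cases hx : x ∈ exceptionalSet b τ
    · rw [Set.indicator_of_mem hx, ENNReal.tsum_mul_right]
      gcongr
      obtain ⟨y, hy, hxy⟩ := hx
      refine le_trans (le_of_eq ?_) (ENNReal.sum_le_tsum (cell b τ y))
      have h2 : ∀ y' ∈ cell b τ y, u x y' = (vol (b (τ y)) : ℝ≥0∞)⁻¹ * L := by
        intro y' hy'
        have h3 := hτ.eq_of_mem hy'
        rw [hu]
        dsimp only
        rw [if_pos, h3]
        refine ⟨h3 ▸ hy, (hmemN _ _).2 (h3 ▸ sub_mem_symBox_of_lt fun i => ?_)⟩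
        -- The box of radius 4 is centred at `y` and `y'` is less than one side away; this is why
        -- 5H' is needed.
        have h4 := abs_lt.1 (abs_sub_lt_of_atomIndex_eq (mem_atom.1 hy') i)
        have h5 := abs_le.1 (mem_nb.1 hxy i)
        push_cast at h5 ⊢
        rw [abs_lt]
        constructor <;> linarith [h4.1, h4.2, h5.1, h5.2]
      rw [Finset.sum_congr rfl h2, Finset.sum_const, card_cell, nsmul_eq_mul, ← mul_assoc,
        vol_mul_inv, one_mul]
    · rw [Set.indicator_of_notMem hx, mul_zero]
      exact zero_le
  have h2 : ∀ y, ∑' x, u x y * V x ≤ B * (normAverage (b (τ y)) f y * V y) := by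
    intro y
    by_cases hy : 0 < τ y
    · rw [tsum_eq_sum (s := N y)]
      · calc ∑ x ∈ N y, u x y * V x
            = ∑ x ∈ N y, (vol (b (τ y)) : ℝ≥0∞)⁻¹ * L * V x := by
              refine Finset.sum_congr rfl fun x hx => ?_
              rw [hu]
              dsimp only
              rw [if_pos ⟨hy, hx⟩]
          _ = (vol (b (τ y)) : ℝ≥0∞)⁻¹ * L * ∑ x ∈ N y, V x := by rw [Finset.mul_sum]
          _ ≤ (vol (b (τ y)) : ℝ≥0∞)⁻¹ * L * (B * vol (b (τ y)) * V y) :=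
              mul_le_mul' le_rfl (hV (τ y) (N y) y y (fun x hx => (hmemN x y).1 hx)
                (sub_mem_symBox_of_mem_nb (self_mem_nb _ _ _)))
          _ = (vol (b (τ y)) * (vol (b (τ y)) : ℝ≥0∞)⁻¹) * (B * (L * V y)) := by ring
          _ ≤ _ := by
              rw [vol_mul_inv, one_mul]
              gcongr
              exact hL y hy
      · intro x hx
        rw [hu]
        simp [hx]
    · have : ∀ x, u x y = 0 := fun x => if_neg fun h => hy h.1
      simp [this]
  calc L * ∑' x, (exceptionalSet b τ).indicator V x
      ≤ ∑' x, ∑' y, u x y * V x := by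
        rw [← ENNReal.tsum_mul_left]
        exact ENNReal.tsum_le_tsum h1
    _ = ∑' y, ∑' x, u x y * V x := ENNReal.tsum_comm
    _ ≤ B * ∑' y, normAverage (b (τ y)) f y * V y := by
        rw [← ENNReal.tsum_mul_left]
        exact ENNReal.tsum_le_tsum h2
    _ ≤ B * (B * ∑' y, ‖f y‖ₑ * V y) := by
        gcongr
        exact hτ.tsum_normAverage_mul_le f hV
    _ = _ := by ring

/-! The bad part. -/

/-- The part of the bad function that lives on cells of generation comparable to `i`. -/
def badPart (b : ℕ → Fin d → ℕ) (τ γ : (Fin d → ℤ) → ℕ) (f : (Fin d → ℤ) → ℂ) (i : ℕ)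
    (x : Fin d → ℤ) : ℂ := if γ x = i then f x - goodPart b τ f x else 0

/-- As `γ` depends only on the generation, the points of `U` with `γ = i` form a union of cells,
over which the good part has the same sum as `f`. -/
theorem cell_subset_filter (hτ : IsStopping b τ) {γ : (Fin d → ℤ) → ℕ}
    (hγ : ∀ x y, τ x = τ y → γ x = γ y) {e : Fin d → ℕ} {i : ℕ} (he : ∀ x, γ x = i → b (τ x) ≤ e)
    {U : Finset (Fin d → ℤ)} (hU : IsUnionOfAtoms e U) :
    ∀ x ∈ U.filter (fun x => γ x = i), cell b τ x ⊆ U.filter (fun x => γ x = i) := by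
  intro x hx y hy
  rw [Finset.mem_filter] at hx ⊢
  refine ⟨hU x y hx.1 (atomIndex_mono (he x hx.2) (mem_atom.1 hy).symm), ?_⟩
  rw [hγ y x (hτ.eq_of_mem hy), hx.2]

theorem meanZero_badPart (hτ : IsStopping b τ) {γ : (Fin d → ℤ) → ℕ}
    (hγ : ∀ x y, τ x = τ y → γ x = γ y) {e : Fin d → ℕ} {i : ℕ} (he : ∀ x, γ x = i → b (τ x) ≤ e)
    (f : (Fin d → ℤ) → ℂ) : MeanZero e (badPart b τ γ f i) := by
  intro m
  simp only [badPart]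
  rw [← Finset.sum_filter, Finset.sum_sub_distrib, hτ.sum_goodPart
    (cell_subset_filter hτ hγ he (isUnionOfAtoms_atom le_rfl m)), sub_self]

/-- Over a union of cells, |f| and its cell averages have equal sums, and the averages are at most
2L; `f` and the good part together give 4L. -/
theorem isMajorant_badPart (hτ : IsStopping b τ) {γ : (Fin d → ℤ) → ℕ}
    (hγ : ∀ x y, τ x = τ y → γ x = γ y) {e : Fin d → ℕ} {i : ℕ} (he : ∀ x, γ x = i → b (τ x) ≤ e)
    {f : (Fin d → ℤ) → ℂ} {L : ℝ≥0∞} (hL : ∀ x, normAverage (b (τ x)) f x ≤ 2 * L) :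
    IsMajorant e (badPart b τ γ f i) fun x => 4 * L * ‖badPart b τ γ f i x‖ₑ := by
  refine IsMajorant.mul fun U hU => ?_
  set S := U.filter fun x => γ x = i with hS
  have hcell := cell_subset_filter hτ hγ he hU
  calc ∑ x ∈ U, ‖badPart b τ γ f i x‖ₑ = ∑ x ∈ S, ‖f x - goodPart b τ f x‖ₑ := by
        rw [hS, Finset.sum_filter]
        refine Finset.sum_congr rfl fun x _ => ?_
        rw [badPart]
        split_ifs <;> simp
    _ ≤ ∑ x ∈ S, (‖f x‖ₑ + normAverage (b (τ x)) f x) :=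
        Finset.sum_le_sum fun x _ => enorm_sub_le.trans
          (add_le_add le_rfl (norm_dyadicExpectation_le _ f x))
    _ = 2 * ∑ x ∈ S, normAverage (b (τ x)) f x := by
        rw [Finset.sum_add_distrib, ← hτ.sum_normAverage hcell, two_mul]
    _ ≤ 2 * ∑ x ∈ S, 2 * L := by
        gcongr with x
        exact hL x
    _ = 4 * L * S.card := by
        rw [Finset.sum_const, nsmul_eq_mul]
        ring
    _ ≤ 4 * L * U.card := by
        gcongr
        exact Finset.filter_subset _ _

theorem IsStopping.tsum_badPart_le (hτ : IsStopping b τ) (γ : (Fin d → ℤ) → ℕ)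
    (f : (Fin d → ℤ) → ℂ) {B : ℝ≥0∞} {V : (Fin d → ℤ) → ℝ≥0∞} (hV : IsRectWeight B b V) :
    ∑' i, ∑' x, ‖badPart b τ γ f i x‖ₑ * V x ≤ (1 + B) * ∑' x, ‖f x‖ₑ * V x := by
  rw [ENNReal.tsum_comm]
  have h : ∀ x, ∑' i, ‖badPart b τ γ f i x‖ₑ * V x ≤
      ‖f x‖ₑ * V x + normAverage (b (τ x)) f x * V x := by
    intro x
    rw [tsum_eq_single (γ x) fun i hi => by simp [badPart, hi.symm], badPart, if_pos rfl, ← add_mul]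
    gcongr
    exact enorm_sub_le.trans (add_le_add le_rfl (norm_dyadicExpectation_le _ f x))
  refine (ENNReal.tsum_le_tsum h).trans ?_
  rw [ENNReal.tsum_add, add_mul, one_mul]
  gcongr
  exact hτ.tsum_normAverage_mul_le f hV

end

/-! The stopping generations. -/

open Classical in
/-- The largest generation up to `N` whose average of `|f|` exceeds `L`. -/
def stopGen (b : ℕ → Fin d → ℕ) (f : (Fin d → ℤ) → ℂ) (L : ℝ≥0∞) (N : ℕ) (x : Fin d → ℤ) : ℕ :=
  Nat.findGreatest (fun j => L < normAverage (b j) f x) N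

section

variable {b : ℕ → Fin d → ℕ} {f : (Fin d → ℤ) → ℂ} {L : ℝ≥0∞} {N : ℕ}

theorem normAverage_congr {e : Fin d → ℕ} (f : (Fin d → ℤ) → ℂ) {x y : Fin d → ℤ}
    (h : atomIndex e x = atomIndex e y) : normAverage e f x = normAverage e f y := by
  rw [normAverage, normAverage, h]

theorem lt_normAverage_stopGen {x : Fin d → ℤ} (h : 0 < stopGen b f L N x) :
    L < normAverage (b (stopGen b f L N x)) f x := by
  classical
  exact Nat.findGreatest_of_ne_zero (P := fun j => L < normAverage (b j) f x) rfl h.ne'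

theorem normAverage_le_of_stopGen_lt (hN : ∀ j x, N < j → normAverage (b j) f x ≤ L)
    {x : Fin d → ℤ} {j : ℕ} (h : stopGen b f L N x < j) : normAverage (b j) f x ≤ L := by
  classical
  by_cases hj : j ≤ N
  · exact not_lt.1 (Nat.findGreatest_is_greatest (P := fun j => L < normAverage (b j) f x) h hj)
  · exact hN j x (not_le.1 hj)

/-- Maximality: averages agree within an atom, so two points in one stopping atom cannot have
different last generations with average above `L`. Generation 0, also the default when no average
exceeds `L`, gives singletons because `b 0 = 0`. -/
theorem isStopping_stopGen (hb0 : b 0 = 0) (hb : Monotone b)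
    (hN : ∀ j x, N < j → normAverage (b j) f x ≤ L) : IsStopping b (stopGen b f L N) := by
  intro x y hxy
  rcases Nat.eq_zero_or_pos (stopGen b f L N x) with h0 | h0
  · rw [h0, hb0, atomIndex_zero, atomIndex_zero] at hxy
    rw [hxy]
  · refine le_antisymm (le_of_not_gt fun hlt => ?_) (le_of_not_gt fun hlt => ?_)
    · have h1 := lt_normAverage_stopGen (h0.trans hlt)
      have h2 := normAverage_le_of_stopGen_lt hN hlt
      rw [normAverage_congr f (atomIndex_mono (hb hlt.le) hxy)] at h2
      exact absurd h1 (not_lt.2 h2)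
    · have h1 := lt_normAverage_stopGen h0
      have h2 := normAverage_le_of_stopGen_lt hN hlt
      rw [normAverage_congr f hxy] at h1
      exact absurd h1 (not_lt.2 h2)

/-- This is where the refinement matters: consecutive rectangles of the original sequence may differ
by an arbitrarily large factor, which would spoil the bound 2L on stopping averages. -/
theorem normAverage_le_two_mul {e e' : Fin d → ℕ} (h : e ≤ e') (h2 : vol e' = 2 * vol e)
    (f : (Fin d → ℤ) → ℂ) (x : Fin d → ℤ) : normAverage e f x ≤ 2 * normAverage e' f x := by
  have h3 : (vol e : ℝ≥0∞)⁻¹ = 2 * (vol e' : ℝ≥0∞)⁻¹ := by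
    rw [h2]
    push_cast
    rw [ENNReal.mul_inv (Or.inl (by simp)) (Or.inl (by simp)), ← mul_assoc,
      ENNReal.mul_inv_cancel (by simp) (by simp), one_mul]
  rw [normAverage, normAverage, h3, mul_assoc]
  gcongr
  intro y hy
  rw [mem_atom] at hy ⊢
  exact atomIndex_mono h hy

end

theorem IsRefinement.isDyadicSequence {a b : ℕ → Fin d → ℕ} (h : IsRefinement a b) :
    IsDyadicSequence b where
  zero := h.zero
  mono := h.mono
  strict k := by
    by_contra! hcon
    have h1 := h.step k
    have h2 : ∑ i, b (k + 1) i ≤ ∑ i, b k i := Finset.sum_le_sum fun i _ => hcon i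
    omega

theorem IsRefinement.vol_succ {a b : ℕ → Fin d → ℕ} (h : IsRefinement a b) (j : ℕ) :
    vol (b (j + 1)) = 2 * vol (b j) := by
  rw [vol_eq, vol_eq, h.step j, pow_succ, mul_comm]

theorem IsDyadicSequence.exists_normAverage_le {b : ℕ → Fin d → ℕ} (hb : IsDyadicSequence b)
    {f : (Fin d → ℤ) → ℂ} (hf : ∑' x, ‖f x‖ₑ ≠ ⊤) {L : ℝ≥0∞} (hL : L ≠ 0) :
    ∃ N, ∀ j x, N < j → normAverage (b j) f x ≤ L := by
  have h1 := ENNReal.Tendsto.mul_const hb.tendsto_inv_vol (Or.inr hf)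
  rw [zero_mul] at h1
  obtain ⟨N, hN⟩ := Filter.eventually_atTop.1 (h1.eventually (ge_mem_nhds (pos_iff_ne_zero.2 hL)))
  refine ⟨N, fun j x hj => le_trans ?_ (hN j hj.le)⟩
  rw [normAverage]
  gcongr
  exact ENNReal.sum_le_tsum _

/-! ### The weak type estimate. -/

/-- Summation over pairs of scales. -/
theorem tsum_sum_range_mul_le (ι : ℕ → ℝ≥0) (β : ℕ → ℝ≥0∞) :
    ∑' k, ∑ i ∈ Finset.range (k + 1), (ι (k - i) : ℝ≥0∞) * β i ≤
      (∑' l, (ι l : ℝ≥0∞)) * ∑' i, β i := by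
  have h1 : ∀ k, ∑ i ∈ Finset.range (k + 1), (ι (k - i) : ℝ≥0∞) * β i =
      ∑' i, {k | i ≤ k}.indicator (fun k => (ι (k - i) : ℝ≥0∞)) k * β i := by
    intro k
    rw [tsum_eq_sum (s := Finset.range (k + 1))]
    · refine Finset.sum_congr rfl fun i hi => ?_
      have : i ≤ k := Nat.lt_succ_iff.1 (Finset.mem_range.1 hi)
      simp [this]
    · intro i hi
      have : ¬ i ≤ k := fun h => hi (Finset.mem_range.2 (Nat.lt_succ_iff.2 h))
      simp [this]
  simp only [h1]
  rw [ENNReal.tsum_comm, ← ENNReal.tsum_mul_left]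
  refine ENNReal.tsum_le_tsum fun i => ?_
  rw [ENNReal.tsum_mul_right]
  refine mul_le_mul' ?_ le_rfl
  refine tsum_indicator_comp_le {k | i ≤ k} (fun k => k - i) ?_ fun l => (ι l : ℝ≥0∞)
  intro k hk k' hk' h
  simp only [Set.mem_ofPred_eq] at hk hk' h
  omega

theorem sum_range_coe_le (ι : ℕ → ℝ≥0) (k : ℕ) :
    ∑ i ∈ Finset.range (k + 1), (ι (k - i) : ℝ≥0∞) ≤ ∑' l, (ι l : ℝ≥0∞) := by
  have := Finset.sum_range_reflect (fun l => (ι l : ℝ≥0∞)) (k + 1)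
  simp only [Nat.add_sub_cancel] at this
  rw [this]
  exact ENNReal.sum_le_tsum _

namespace ScaleOperators

variable {a b : ℕ → Fin d → ℕ} {ι : ℕ → ℝ≥0} {C : ℝ≥0}
  {T : ℕ → ((Fin d → ℤ) → ℂ) → (Fin d → ℤ) → ℝ≥0∞}

/-- Cancellation gives `ι (k - i) ^ 2`; Cauchy–Schwarz with weights `ι (k - i)` uses one factor in
the sum over `i`, and the other is summed over `k`. The averages over boxes are moved onto `V` and
absorbed by the weight condition. -/
theorem tsum_sq_bad_mul_le (hT : ScaleOperators a ι C 4 T) (hι : ∀ l, ι l ≠ 0) {B L : ℝ≥0∞}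
    {V : (Fin d → ℤ) → ℝ≥0∞} (hV : IsRectWeight B a V) {β : ℕ → (Fin d → ℤ) → ℂ}
    (hβ : ∀ i, MeanZero (a i) (β i)) (hβ' : ∀ i, IsMajorant (a i) (β i) fun x => L * ‖β i x‖ₑ) :
    ∑' k, ∑' x, T k (∑ i ∈ Finset.range (k + 1), β i) x ^ 2 * V x ≤
      C * L * B * (∑' l, (ι l : ℝ≥0∞)) ^ 2 * ∑' i, ∑' x, ‖β i x‖ₑ * V x := by
  set s := ∑' l, (ι l : ℝ≥0∞) with hs
  have hpt : ∀ k x, T k (∑ i ∈ Finset.range (k + 1), β i) x ^ 2 ≤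
      s * ∑ i ∈ Finset.range (k + 1), (ι (k - i) : ℝ≥0∞) *
        (C * L * ((vol (a k) : ℝ≥0∞)⁻¹ * ∑ y ∈ nb 4 (a k) x, ‖β i y‖ₑ)) := by
    intro k x
    calc _ ≤ (∑ i ∈ Finset.range (k + 1), T k (β i) x) ^ 2 :=
          pow_le_pow_left' (hT.sum_le k β x _) 2
      _ ≤ _ := sq_sum_le_weighted _ (fun i => (ι (k - i) : ℝ≥0∞)) _
          (fun i => by exact_mod_cast hι _) fun i => ENNReal.coe_ne_top
      _ ≤ _ := by
          refine mul_le_mul' (sum_range_coe_le ι k) (Finset.sum_le_sum fun i hi => ?_)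
          have hik : i ≤ k := Nat.lt_succ_iff.1 (Finset.mem_range.1 hi)
          have h0 : (ι (k - i) : ℝ≥0∞) ≠ 0 := by exact_mod_cast hι _
          refine (mul_le_mul' le_rfl (hT.cancel i k (β i) _ x hik (hβ i) (hβ' i))).trans
            (le_of_eq ?_)
          rw [← Finset.mul_sum]
          calc _ = ((ι (k - i) : ℝ≥0∞) * (ι (k - i) : ℝ≥0∞)⁻¹) * ((ι (k - i) : ℝ≥0∞) *
                (C * L * ((vol (a k) : ℝ≥0∞)⁻¹ * ∑ y ∈ nb 4 (a k) x, ‖β i y‖ₑ))) := by ring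
            _ = _ := by rw [ENNReal.mul_inv_cancel h0 ENNReal.coe_ne_top, one_mul]
  have hswap : ∀ k i, ∑' x, ((vol (a k) : ℝ≥0∞)⁻¹ * ∑ y ∈ nb 4 (a k) x, ‖β i y‖ₑ) * V x ≤
      B * ∑' x, ‖β i x‖ₑ * V x := by
    intro k i
    calc _ = ∑' x, (vol (a k) : ℝ≥0∞)⁻¹ * V x * ∑ y ∈ nb 4 (a k) x, ‖β i y‖ₑ :=
          tsum_congr fun x => by ring
      _ = _ := tsum_mul_sum_comm (nb 4 (a k)) (fun _ _ => mem_nb_comm) _ _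
      _ ≤ _ := by
          rw [← ENNReal.tsum_mul_left]
          refine ENNReal.tsum_le_tsum fun y => ?_
          rw [← Finset.mul_sum]
          refine (mul_le_mul' le_rfl (hV.sum_nb_le k y)).trans (le_of_eq ?_)
          ring
  have hk : ∀ k, ∑' x, T k (∑ i ∈ Finset.range (k + 1), β i) x ^ 2 * V x ≤
      C * L * B * s * ∑ i ∈ Finset.range (k + 1),
        (ι (k - i) : ℝ≥0∞) * ∑' x, ‖β i x‖ₑ * V x := by
    intro k
    calc _ ≤ ∑' x, ∑ i ∈ Finset.range (k + 1), s * (ι (k - i) : ℝ≥0∞) * (C * L) *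
          (((vol (a k) : ℝ≥0∞)⁻¹ * ∑ y ∈ nb 4 (a k) x, ‖β i y‖ₑ) * V x) := by
          refine ENNReal.tsum_le_tsum fun x => (mul_le_mul' (hpt k x) le_rfl).trans (le_of_eq ?_)
          rw [mul_assoc, Finset.sum_mul, Finset.mul_sum (Finset.range (k + 1))]
          refine Finset.sum_congr rfl fun i _ => ?_
          ring
      _ = ∑ i ∈ Finset.range (k + 1), s * (ι (k - i) : ℝ≥0∞) * (C * L) *
          ∑' x, ((vol (a k) : ℝ≥0∞)⁻¹ * ∑ y ∈ nb 4 (a k) x, ‖β i y‖ₑ) * V x := by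
          rw [Summable.tsum_finsetSum fun i _ => ENNReal.summable]
          simp only [ENNReal.tsum_mul_left]
      _ ≤ ∑ i ∈ Finset.range (k + 1), s * (ι (k - i) : ℝ≥0∞) * (C * L) *
          (B * ∑' x, ‖β i x‖ₑ * V x) :=
          Finset.sum_le_sum fun i _ => mul_le_mul' le_rfl (hswap k i)
      _ = _ := by
          rw [Finset.mul_sum (Finset.range (k + 1))]
          refine Finset.sum_congr rfl fun i _ => ?_
          ring
  calc _ ≤ _ := ENNReal.tsum_le_tsum hk
    _ ≤ C * L * B * s * (s * ∑' i, ∑' x, ‖β i x‖ₑ * V x) := by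
        rw [ENNReal.tsum_mul_left]
        gcongr
        exact tsum_sum_range_mul_le ι _
    _ = _ := by ring

/-- The weighted weak type estimate for integrable functions. -/
theorem weak_type_of_summable (hT : ScaleOperators a ι C 4 T)
    (hatom : ∀ k f x y, atomIndex (a k) x = atomIndex (a k) y → T k f x = T k f y)
    (hι : ∀ l, ι l ≠ 0) (hb : IsRefinement a b)
    {B B₂ : ℝ≥0∞} (hB₂t : B₂ ≠ ⊤) (hB₂ : ∀ f : (Fin d → ℤ) → ℂ, ∑' x, ‖f x‖ₑ ^ 2 ≠ ⊤ →
      ∑' k, ∑' x, T k f x ^ 2 ≤ B₂ * ∑' x, ‖f x‖ₑ ^ 2)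
    {V : (Fin d → ℤ) → ℝ≥0∞} (hV : IsRectWeight B b V) {f : (Fin d → ℤ) → ℂ}
    (hf : ∑' x, ‖f x‖ₑ ≠ ⊤) {L : ℝ≥0∞} (hL0 : L ≠ 0) (hLt : L ≠ ⊤) :
    L * ∑' x, {x | L < (∑' k, T k f x ^ 2) ^ (1 / 2 : ℝ)}.indicator V x ≤
      (B ^ 2 + 4 * B ^ 2 * B₂ + 8 * C * B * (1 + B) * (∑' l, (ι l : ℝ≥0∞)) ^ 2) *
        ∑' x, ‖f x‖ₑ * V x := by
  classical
  set s := ∑' l, (ι l : ℝ≥0∞) with hs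
  set F := ∑' x, ‖f x‖ₑ * V x with hF
  obtain ⟨J, hJ, hJa⟩ := hb.contains
  have hVa : IsRectWeight B a V := fun k S y z hS hz => by
    rw [← hJa k] at hS hz ⊢
    exact hV (J k) S y z hS hz
  obtain ⟨N, hN⟩ := hb.isDyadicSequence.exists_normAverage_le hf hL0
  set τ := stopGen b f L N with hτdef
  have hτ : IsStopping b τ := isStopping_stopGen hb.zero hb.mono hN
  have havg : ∀ x, normAverage (b (τ x)) f x ≤ 2 * L := fun x =>
    (normAverage_le_two_mul (hb.mono (Nat.le_succ _)) (hb.vol_succ _) f x).trans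
      (mul_le_mul' le_rfl (normAverage_le_of_stopGen_lt hN (Nat.lt_succ_self _)))
  have hex : ∀ x, ∃ i, τ x ≤ J i := fun x => ⟨τ x, hJ.id_le _⟩
  -- The first scale of the original sequence that is at least as coarse as the stopping cell: the
  -- cells lie in the refinement, but cancellation is available only for atoms of `a`.
  set γ : (Fin d → ℤ) → ℕ := fun x => Nat.find (hex x) with hγdef
  have hγ : ∀ x y, τ x = τ y → γ x = γ y := by
    intro x y hxy
    simp only [hγdef, hxy]
  have hγle : ∀ i x, γ x = i → b (τ x) ≤ a i := by
    rintro i x rfl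
    rw [← hJa]
    exact hb.mono (Nat.find_spec (hex x))
  set g := goodPart b τ f with hg
  set β := badPart b τ γ f with hβ
  have hgood : ∀ x, ‖g x‖ₑ ≤ normAverage (b (τ x)) f x := fun x => norm_dyadicExpectation_le _ f x
  have hgood2 : ∀ x, ‖g x‖ₑ ^ 2 ≤ 2 * L * normAverage (b (τ x)) f x := fun x => by
    rw [pow_two]
    exact mul_le_mul' ((hgood x).trans (havg x)) (hgood x)
  have hg2 : ∑' x, ‖g x‖ₑ ^ 2 ≠ ⊤ := by
    refine ne_top_of_le_ne_top ?_ (ENNReal.tsum_le_tsum hgood2)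
    rw [ENNReal.tsum_mul_left, hτ.tsum_normAverage]
    finiteness
  -- A point `y` seen from `x` at scale `k` with `γ y > k` lies in a cell of generation beyond `J
  -- k`, so `x` would lie in the enlargement of that cell. Generations 0 need no enlargement, since
  -- `J k < τ y` forces positivity.
  have hlocal : ∀ k x, x ∉ exceptionalSet b τ →
      T k (f - g) x = T k (∑ i ∈ Finset.range (k + 1), β i) x := by
    intro k x hx
    refine hT.congr k _ _ x fun y hy => ?_
    have hyk : γ y ≤ k := by
      by_contra hcon
      have h1 : J k < τ y := by
        by_contra h2
        exact hcon (Nat.find_min' (hex y) (not_lt.1 h2))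
      refine hx ⟨y, (Nat.zero_le _).trans_lt h1, mem_nb.2 fun i => ?_⟩
      refine (mem_nb.1 (mem_nb_comm.1 hy) i).trans ?_
      rw [← hJa k]
      gcongr
      · norm_num
      · exact hb.mono h1.le i
    rw [Finset.sum_apply, Finset.sum_eq_single (γ y)]
    · rw [hβ, badPart, if_pos rfl, Pi.sub_apply]
    · intro i _ hi
      rw [hβ, badPart, if_neg hi.symm]
    · intro h
      exact absurd (Finset.mem_range.2 (Nat.lt_succ_iff.2 hyk)) h
  have hgsum : ∑' k, ∑' x, T k g x ^ 2 * V x ≤ L * (2 * B ^ 2 * B₂ * F) := by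
    calc _ ≤ B * B₂ * ∑' x, ‖g x‖ₑ ^ 2 * V x := hT.tsum_sq_mul_le hatom hB₂t hB₂ hVa hg2
      _ ≤ B * B₂ * ∑' x, 2 * L * (normAverage (b (τ x)) f x * V x) := by
          refine mul_le_mul' le_rfl (ENNReal.tsum_le_tsum fun x => ?_)
          rw [← mul_assoc]
          exact mul_le_mul' (hgood2 x) le_rfl
      _ ≤ B * B₂ * (2 * L * (B * F)) := by
          rw [ENNReal.tsum_mul_left]
          gcongr
          exact hτ.tsum_normAverage_mul_le f hV
      _ = _ := by ring
  have hbsum : ∑' k, ∑' x, T k (∑ i ∈ Finset.range (k + 1), β i) x ^ 2 * V x ≤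
      L * (4 * C * B * (1 + B) * s ^ 2 * F) := by
    calc _ ≤ C * (4 * L) * B * s ^ 2 * ∑' i, ∑' x, ‖β i x‖ₑ * V x :=
          hT.tsum_sq_bad_mul_le hι hVa (fun i => meanZero_badPart hτ hγ (hγle i) f)
            fun i => isMajorant_badPart hτ hγ (hγle i) havg
      _ ≤ C * (4 * L) * B * s ^ 2 * ((1 + B) * F) :=
          mul_le_mul' le_rfl (hτ.tsum_badPart_le γ f hV)
      _ = _ := by ring
  set S := {x | L < (∑' k, T k f x ^ 2) ^ (1 / 2 : ℝ)} with hS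
  -- Chebyshev's inequality for squares produces `L ^ 2`; one factor `L` is cancelled at the end, as
  -- every term on the right carries one.
  have hmain : ∀ x, L * (L * S.indicator V x) ≤
      L * (L * (exceptionalSet b τ).indicator V x) +
        (2 * ∑' k, T k g x ^ 2 * V x +
          2 * ∑' k, T k (∑ i ∈ Finset.range (k + 1), β i) x ^ 2 * V x) := by
    intro x
    by_cases hxS : x ∈ S
    · by_cases hx : x ∈ exceptionalSet b τ
      · rw [Set.indicator_of_mem hxS, Set.indicator_of_mem hx]
        exact le_self_add
      · rw [Set.indicator_of_mem hxS, Set.indicator_of_notMem hx, mul_zero, mul_zero, zero_add,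
          ← mul_assoc, ← pow_two]
        calc L ^ 2 * V x ≤ (∑' k, T k f x ^ 2) * V x :=
              mul_le_mul' (lt_rpow_half_iff.1 hxS).le le_rfl
          _ ≤ (∑' k, (2 * T k g x ^ 2 +
                2 * T k (∑ i ∈ Finset.range (k + 1), β i) x ^ 2)) * V x := by
              refine mul_le_mul' (ENNReal.tsum_le_tsum fun k => ?_) le_rfl
              refine le_trans (pow_le_pow_left' ?_ 2) (add_sq_le_two _ _)
              rw [← hlocal k x hx]
              calc T k f x = T k (g + (f - g)) x := by rw [add_sub_cancel]
                _ ≤ _ := hT.add_le k _ _ x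
          _ = _ := by
              rw [ENNReal.tsum_add, ENNReal.tsum_mul_left, ENNReal.tsum_mul_left,
                ENNReal.tsum_mul_right, ENNReal.tsum_mul_right]
              ring
    · rw [Set.indicator_of_notMem hxS, mul_zero, mul_zero]
      exact zero_le
  have hfinal : L * (L * ∑' x, S.indicator V x) ≤ L * ((B ^ 2 + 4 * B ^ 2 * B₂ +
      8 * C * B * (1 + B) * s ^ 2) * F) := by
    calc L * (L * ∑' x, S.indicator V x) = ∑' x, L * (L * S.indicator V x) := by
          rw [ENNReal.tsum_mul_left, ENNReal.tsum_mul_left]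
      _ ≤ _ := ENNReal.tsum_le_tsum hmain
      _ = L * (L * ∑' x, (exceptionalSet b τ).indicator V x) +
          (2 * ∑' k, ∑' x, T k g x ^ 2 * V x +
            2 * ∑' k, ∑' x, T k (∑ i ∈ Finset.range (k + 1), β i) x ^ 2 * V x) := by
          rw [ENNReal.tsum_add, ENNReal.tsum_add, ENNReal.tsum_mul_left, ENNReal.tsum_mul_left,
            ENNReal.tsum_mul_left, ENNReal.tsum_mul_left, ENNReal.tsum_comm,
            ENNReal.tsum_comm (f := fun x k => T k (∑ i ∈ Finset.range (k + 1), β i) x ^ 2 * V x)]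
      _ ≤ L * (B ^ 2 * F) + (2 * (L * (2 * B ^ 2 * B₂ * F)) +
            2 * (L * (4 * C * B * (1 + B) * s ^ 2 * F))) :=
          add_le_add (mul_le_mul' le_rfl (hτ.weight_exceptionalSet_le
            (fun y hy => (lt_normAverage_stopGen hy).le) hV))
            (add_le_add (mul_le_mul' le_rfl hgsum) (mul_le_mul' le_rfl hbsum))
      _ = _ := by ring
  exact (ENNReal.mul_le_mul_iff_right hL0 hLt).1 hfinal

/-- By locality, the weak type estimate extends to all functions. -/
theorem weak_type_of_finite (hT : ScaleOperators a ι C 4 T) {C₁ : ℝ≥0∞}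
    {V : (Fin d → ℤ) → ℝ≥0∞} {L : ℝ≥0∞} (h : ∀ f : (Fin d → ℤ) → ℂ, ∑' x, ‖f x‖ₑ ≠ ⊤ →
      L * ∑' x, {x | L < (∑' k, T k f x ^ 2) ^ (1 / 2 : ℝ)}.indicator V x ≤
        C₁ * ∑' x, ‖f x‖ₑ * V x) (f : (Fin d → ℤ) → ℂ) :
    L * ∑' x, {x | L < (∑' k, T k f x ^ 2) ^ (1 / 2 : ℝ)}.indicator V x ≤
      C₁ * ∑' x, ‖f x‖ₑ * V x := by
  classical
  rw [ENNReal.tsum_eq_iSup_sum, ENNReal.mul_iSup]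
  refine iSup_le fun G => ?_
  -- The strict inequality is already reached by a finite partial sum, so finitely many scales
  -- suffice at each point of the finite set `G`.
  have hn : ∀ x, ∃ n, L < (∑' k, T k f x ^ 2) ^ (1 / 2 : ℝ) →
      L ^ 2 < ∑ k ∈ Finset.range n, T k f x ^ 2 := by
    intro x
    by_cases hx : L < (∑' k, T k f x ^ 2) ^ (1 / 2 : ℝ)
    · rw [lt_rpow_half_iff, ENNReal.tsum_eq_iSup_nat, lt_iSup_iff] at hx
      obtain ⟨n, hn⟩ := hx
      exact ⟨n, fun _ => hn⟩
    · exact ⟨0, fun h => absurd h hx⟩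
  choose n hn using hn
  -- All points seen from `G` at these scales: a finite set, so the restriction of `f` to it is
  -- summable.
  set U := G.biUnion fun x => (Finset.range (n x)).biUnion fun k => nb 4 (a k) x with hU
  set f' : (Fin d → ℤ) → ℂ := fun y => if y ∈ U then f y else 0 with hf'
  have hf't : ∑' x, ‖f' x‖ₑ ≠ ⊤ := by
    rw [tsum_eq_sum (s := U) fun x hx => by simp [hf', hx]]
    exact ENNReal.sum_ne_top.2 fun x _ => enorm_ne_top
  have hsub : ∀ x ∈ G, {x | L < (∑' k, T k f x ^ 2) ^ (1 / 2 : ℝ)}.indicator V x ≤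
      {x | L < (∑' k, T k f' x ^ 2) ^ (1 / 2 : ℝ)}.indicator V x := by
    intro x hx
    by_cases hxS : L < (∑' k, T k f x ^ 2) ^ (1 / 2 : ℝ)
    · rw [Set.indicator_of_mem (show x ∈ {x | L < (∑' k, T k f x ^ 2) ^ (1 / 2 : ℝ)} from hxS),
        Set.indicator_of_mem]
      refine lt_rpow_half_iff.2 ((hn x hxS).trans_le ?_)
      refine le_trans (le_of_eq (Finset.sum_congr rfl fun k hk => ?_)) (ENNReal.sum_le_tsum _)
      rw [hT.congr k f f' x fun y hy => (if_pos ?_).symm]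
      exact Finset.mem_biUnion.2 ⟨x, hx, Finset.mem_biUnion.2 ⟨k, hk, hy⟩⟩
    · rw [Set.indicator_of_notMem (show x ∉ {x | L < (∑' k, T k f x ^ 2) ^ (1 / 2 : ℝ)} from hxS)]
      exact zero_le
  calc _ ≤ L * ∑' x, {x | L < (∑' k, T k f' x ^ 2) ^ (1 / 2 : ℝ)}.indicator V x := by
        gcongr
        exact (Finset.sum_le_sum hsub).trans (ENNReal.sum_le_tsum _)
    _ ≤ C₁ * ∑' x, ‖f' x‖ₑ * V x := h f' hf't
    _ ≤ _ := by
        gcongr with x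
        rw [hf']
        dsimp only
        split_ifs <;> simp

end ScaleOperators

/-! The square functions. -/

theorem JRWCriteria.mono {c : ℝ} {ι ε ι' ε' : ℕ → ℝ≥0} {a : ℕ → Fin d → ℕ}
    {𝒜 : ℕ → Set (Finset (Fin d → ℤ))} (hA : JRWCriteria c ι ε a 𝒜) (hι : ∀ l, ι l ≤ ι' l)
    (hε : ∀ l, ε l ≤ ε' l) : JRWCriteria c ι' ε' a 𝒜 where
  location := hA.location
  size := hA.size
  smoothness k l E hE := (hA.smoothness k l E hE).trans (by gcongr; exact hι l)
  eccentricity k l := (hA.eccentricity k l).trans (by gcongr; exact hε l)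

/-- The constant of the unweighted `ℓ²` estimate, `s` being the sum of the decay rates. -/
def ellTwoConst (d : ℕ) (C : ℝ≥0) (s : ℝ≥0∞) : ℝ≥0∞ := C * 9 ^ d * (32 * d + 1) * s ^ 2

/-- The constant of the weighted weak type estimate, `B` being the constant of the weight. -/
def weakConst (d : ℕ) (C : ℝ≥0) (s B : ℝ≥0∞) : ℝ≥0∞ :=
  B ^ 2 + 4 * B ^ 2 * ellTwoConst d C s + 8 * C * B * (1 + B) * s ^ 2

theorem ScaleOperators.weak_type {a b : ℕ → Fin d → ℕ} {ι ε : ℕ → ℝ≥0} {C : ℝ≥0}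
    {T : ℕ → ((Fin d → ℤ) → ℂ) → (Fin d → ℤ) → ℝ≥0∞} (hT : ScaleOperators a ι C 1 T)
    (ha : IsDyadicSequence a) (hb : IsRefinement a b) (hι : ∀ l, ι l ≠ 0) (hε : ∀ l, ε l ≠ 0)
    (hecc : ∀ k q, k ≤ q → ∀ i, (2 : ℝ≥0) ^ a k i ≤ 2 * ε (q - k) ^ 2 * 2 ^ a q i)
    {s : ℝ≥0∞} (hs : s = ∑' l, (ι l : ℝ≥0∞) + ∑' l, (ε l : ℝ≥0∞)) (hst : s ≠ ⊤) {B : ℝ≥0∞}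
    {V : (Fin d → ℤ) → ℝ≥0∞} (hV : IsRectWeight B b V) (f : (Fin d → ℤ) → ℂ) {L : ℝ≥0∞}
    (hLt : L ≠ ⊤) :
    L * ∑' x, {x | L < (∑' k, ShiftedSquare.discretized (a k) (T k f) x ^ 2) ^ (1 / 2 : ℝ)}.indicator
      V x ≤ weakConst d (9 ^ d * C) s B * ∑' x, ‖f x‖ₑ * V x := by
  rcases eq_or_ne L 0 with rfl | hL0
  · rw [zero_mul]
    exact zero_le
  have hD := hT.discretized
  refine hD.weak_type_of_finite (fun f hf => ?_) f
  refine (hD.weak_type_of_summable (fun k f x y h => discretized_congr_atom _ h) hι hb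
    (B₂ := ellTwoConst d (9 ^ d * C) s) ?_ (fun f hf => ?_) hV hf hL0 hLt).trans ?_
  · rw [ellTwoConst]
    finiteness
  · rw [ellTwoConst, hs]
    exact hD.tsum_sq_le ha hι hε hecc hf
  · rw [weakConst]
    gcongr
    rw [hs]
    exact le_self_add

end ShiftedSquare

end

/-! ### The weighted weak type estimate for both square functions. -/

theorem mainTheorem8 (d : ℕ) (ι ε : ℕ → ℝ≥0) (hι : Summable ι) (hε : Summable ε)
    (c : ℝ) (hc : 0 < c) (K A : ℝ≥0) :
    ∃ C₁ : ℝ≥0, ∀ (a : ℕ → Fin d → ℕ) (𝒜 : ℕ → Set (Finset (Fin d → ℤ)))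
      (E : ℕ → Finset (Fin d → ℤ)),
      ShiftedSquare.IsDyadicSequence a →
      ShiftedSquare.JRWCriteria c ι ε a 𝒜 →
      ShiftedSquare.IsRegular 𝒜 E →
      ShiftedSquare.IsCubic K a →
      ∀ v : (Fin d → ℤ) → ℝ, ShiftedSquare.IsA1Weight A v →
      ∀ (f : (Fin d → ℤ) → ℂ) (lam : ℝ≥0),
        (lam : ℝ≥0∞) * ShiftedSquare.weightOf v {x | lam < ShiftedSquare.longSquare a E f x}
            ≤ C₁ * ShiftedSquare.weightedIntegral v f ∧
        (lam : ℝ≥0∞) * ShiftedSquare.weightOf v {x | lam < ShiftedSquare.shortSquare a E f x}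
            ≤ C₁ * ShiftedSquare.weightedIntegral v f := by
  -- The rates serve as weights in Cauchy–Schwarz and are inverted, so they must not vanish; adding
  -- a geometric sequence keeps them summable and dependent only on `ι` and `ε`.
  set ι' : ℕ → ℝ≥0 := fun l => ι l + (1 / 2) ^ l with hι'
  set ε' : ℕ → ℝ≥0 := fun l => ε l + (1 / 2) ^ l with hε'
  have hgeom : Summable fun l : ℕ => ((1 / 2 : ℝ≥0)) ^ l :=
    NNReal.summable_geometric (by rw [← NNReal.coe_lt_coe]; norm_num)
  have hι0 : ∀ l, ι' l ≠ 0 := fun l => by positivity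
  have hε0 : ∀ l, ε' l ≠ 0 := fun l => by positivity
  set s : ℝ≥0∞ := ∑' l, (ι' l : ℝ≥0∞) + ∑' l, (ε' l : ℝ≥0∞) with hs
  have hst : s ≠ ⊤ := ENNReal.add_ne_top.2
    ⟨ENNReal.tsum_coe_ne_top_iff_summable.2 (hι.add hgeom),
      ENNReal.tsum_coe_ne_top_iff_summable.2 (hε.add hgeom)⟩
  set C₁ : ℝ≥0∞ := ShiftedSquare.weakConst d (9 ^ d * ShiftedSquare.scaleConst c) s
    (K * A * 10 ^ d) with hC₁
  have hC₁t : C₁ ≠ ⊤ := by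
    rw [hC₁, ShiftedSquare.weakConst, ShiftedSquare.ellTwoConst]
    finiteness
  refine ⟨C₁.toNNReal, fun a 𝒜 E ha hA hE hK v hv f lam => ?_⟩
  rw [ENNReal.coe_toNNReal hC₁t]
  obtain ⟨b, hb, hbK⟩ := hK
  have hA' : ShiftedSquare.JRWCriteria c ι' ε' a 𝒜 :=
    hA.mono (fun l => le_self_add) fun l => le_self_add
  have hecc : ∀ k q, k ≤ q → ∀ i, (2 : ℝ≥0) ^ a k i ≤ 2 * ε' (q - k) ^ 2 * 2 ^ a q i :=
    fun k q hkq i => hA'.two_pow_le ha.mono hkq i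
  have hV := hv.isRectWeight hbK
  exact ⟨(ShiftedSquare.scaleOperators_longPart hA' hc ha.mono hE).weak_type ha hb hι0 hε0 hecc hs
      hst hV f ENNReal.coe_ne_top,
    (ShiftedSquare.scaleOperators_shortPart hA' hc hE).weak_type ha hb hι0 hε0 hecc hs
      hst hV f ENNReal.coe_ne_top⟩
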